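/- Let $\omega=e^{2\pi i/3}$, and let $X|j\rangle=|j+1 \bmod 3\rangle$, $Z|j\rangle=\omega^j|j\rangle$ be the qutrit Pauli operators. A (stabilizer) 2-EPP on $n$ pairs of qutrits, half of each held by Alice and half by Bob, is a protocol in which Alice and Bob both measure, on their own halves, a sequence of commuting operators from the qutrit Pauli group. After each measurement they tell each other their outcomes, and the next operator may depend on all outcomes so far. At the end they apply local unitaries depending on the outcomes, keep $k$ of the pairs and discard the others. It corrects $t$ errors if, whenever an arbitrary quantum channel has acted on at most $t$ of $n$ perfect EPR pairs $3^{-1/2}\sum_j|j\rangle|j\rangle$ (and the other pairs are untouched), the final state is always exactly $k$ perfect EPR pairs. Then: (1) The stabilizer generated by $X\otimes X\otimes X$ and $Z\otimes Z\otimes Z$ has a coding space $C$ of dimension $3$ (one qutrit encoded in three) that detects one error: for every operator $E$ acting on a single qutrit there is $c\in\mathbb C$ with $\langle\varphi|E|\psi\rangle=c\,\langle\varphi|\psi\rangle$ for all $\varphi,\psi\in C$. (2) The following is a 2-EPP that produces one perfect pair from four pairs of qutrits and corrects one error, for a suitable choice of decoding operations. Alice and Bob each measure $X\otimes X\otimes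 X$ and $Z\otimes Z\otimes Z$ on the first three pairs, with outcomes $\omega^{a_1},\omega^{a_2}$ (Alice) and $\omega^{b_1},\omega^{b_2}$ (Bob). If the outcomes differ from what they must satisfy in the absence of errors, namely $a_1+b_1\equiv0$ and $a_2\equiv b_2 \pmod 3$, an error is detected; they keep the fourth pair and discard the first three. Otherwise they discard the fourth pair, each applies to the first three qutrits a decoding operation of the code for his or her own syndrome (a unitary carrying the joint eigenspace with that syndrome to $\mathbb C^3\otimes|00\rangle$), and they keep the resulting decoded pair. (3) Let $d\ge2$ and $k\ge1$. Every quantum error-correcting code that encodes $k$ qudits of dimension $d$ into $n$ such qudits (an isometric encoder followed, after the errors, by a decoding channel) and restores the encoded state exactly after an arbitrary channel acting on at most $t$ of the $n$ qudits obeys the quantum Singleton bound $n\ge 4t+k$. (4) The 2-EPP of (2), with $n=4$, $k=1$, $t=1$, violates this bound, since $4<4\cdot1+1$; in particular no quantum error-correcting code encodes one qutrit in four and corrects one error. -/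

import Mathlib

open scoped Matrix

namespace QuditEPP

/-! ### Operators, channels and errors on registers

A register of `n` systems, each with computational basis `α`, has computational basis
`Fin n → α`; its operators are the matrices indexed by `Fin n → α`. -/

section Channels

variable {α : Type} [Fintype α] [DecidableEq α]

/-- `actOn e K` is the operator `K ⊗ I` on `n` systems: `K` acts on the systems
`e 0, …, e (m - 1)`, and the identity acts on all the others. -/
def actOn {m n : ℕ} (e : Fin m ↪ Fin n) (K : Matrix (Fin m → α) (Fin m → α) ℂ) :
    Matrix (Fin n → α) (Fin n → α) ℂ :=
  Matrix.of fun x y =>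
    if ∀ i, (∀ j, e j ≠ i) → x i = y i then K (fun j => x (e j)) (fun j => y (e j)) else 0

/-- A quantum channel (a completely positive trace-preserving superoperator) from the system with
basis `A` to the system with basis `B`, given by Kraus operators. -/
structure Channel (A B : Type) [Fintype A] [DecidableEq A] [Fintype B] where
  r : ℕ
  kraus : Fin r → Matrix B A ℂ
  trace_preserving : ∑ i, (kraus i)ᴴ * kraus i = 1

/-- The action of a channel on density matrices. -/
def Channel.apply {A B : Type} [Fintype A] [DecidableEq A] [Fintype B]
    (N : Channel A B) (ρ : Matrix A A ℂ) : Matrix B B ℂ :=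
  ∑ i, N.kraus i * ρ * (N.kraus i)ᴴ

/-- The action on `n` systems of the superoperator `N ⊗ I`, where `N` acts on the systems
`e 0, …, e (m - 1)` and `I` is the identity superoperator on the others. -/
def Channel.applyOn {m n : ℕ} (N : Channel (Fin m → α) (Fin m → α)) (e : Fin m ↪ Fin n)
    (ρ : Matrix (Fin n → α) (Fin n → α) ℂ) : Matrix (Fin n → α) (Fin n → α) ℂ :=
  ∑ i, actOn e (N.kraus i) * ρ * (actOn e (N.kraus i))ᴴ

end Channels

/-! ### Quantum error-correcting codes -/

/-- A quantum error-correcting code encoding `k` systems with basis `α` into `n` such systems: an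
isometric encoder, and a decoder, which may be any channel. -/
structure QECC (α : Type) [Fintype α] [DecidableEq α] (n k : ℕ) where
  encoder : Matrix (Fin n → α) (Fin k → α) ℂ
  isometry : encoderᴴ * encoder = 1
  decoder : Channel (Fin n → α) (Fin k → α)

/-- The code corrects `t` errors: whenever an arbitrary channel acts on at most `t` of the `n`
systems, decoding restores the encoded state exactly. -/
def QECC.Corrects {α : Type} [Fintype α] [DecidableEq α] {n k : ℕ} (C : QECC α n k) (t : ℕ) :
    Prop :=
  ∀ s ≤ t, ∀ (e : Fin s ↪ Fin n) (N : Channel (Fin s → α) (Fin s → α))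
    (ρ : Matrix (Fin k → α) (Fin k → α) ℂ),
    C.decoder.apply (N.applyOn e (C.encoder * ρ * C.encoderᴴ)) = ρ

/-! ### The Pauli group of qudits and stabilizer codes -/

section Pauli

/-- `ω = exp(2πi/d)`. -/
noncomputable def omega (d : ℕ) : ℂ := Complex.exp (2 * Real.pi * Complex.I / d)

/-- `X |j⟩ = |j + 1⟩`, with addition modulo `d`. -/
def shiftX (d : ℕ) [NeZero d] : Matrix (ZMod d) (ZMod d) ℂ :=
  Matrix.of fun x y => if x = y + 1 then 1 else 0

/-- `Z |j⟩ = ω ^ j |j⟩`. -/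
noncomputable def clockZ (d : ℕ) [NeZero d] : Matrix (ZMod d) (ZMod d) ℂ :=
  Matrix.diagonal fun j => omega d ^ j.val

/-- The tensor product `P 0 ⊗ ⋯ ⊗ P (n - 1)` of single-system operators. -/
def tensor {α : Type} {n : ℕ} (P : Fin n → Matrix α α ℂ) : Matrix (Fin n → α) (Fin n → α) ℂ :=
  Matrix.of fun x y => ∏ i, P i (x i) (y i)

/-- The Pauli group on `n` qudits of dimension `d`, generated by the tensor products of `I`, `X`
and `Z`. The generators have finite order, so the generated monoid is a group. -/
noncomputable def pauliGroup (d n : ℕ) [NeZero d] :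
    Submonoid (Matrix (Fin n → ZMod d) (Fin n → ZMod d) ℂ) :=
  Submonoid.closure {M | ∃ P : Fin n → Matrix (ZMod d) (ZMod d) ℂ,
    (∀ i, P i = 1 ∨ P i = shiftX d ∨ P i = clockZ d) ∧ M = tensor P}

/-- The joint eigenspace of the operators `M 0, …, M (r - 1)` with eigenvalues
`ω ^ s 0, …, ω ^ s (r - 1)`. For `s = 0` this is the coding space of the stabilizer generated
by the `M i`. -/
noncomputable def syndromeSpace {d n r : ℕ} [NeZero d]
    (M : Fin r → Matrix (Fin n → ZMod d) (Fin n → ZMod d) ℂ) (s : Fin r → ZMod d) :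
    Submodule ℂ ((Fin n → ZMod d) → ℂ) :=
  ⨅ i, LinearMap.ker (Matrix.toLin' (M i) - (omega d ^ (s i).val) • LinearMap.id)

/-- A coding space `C` detects `t` errors: for every operator `E` on at most `t` systems, the
component in `C` of `E |ψ⟩` is `c |ψ⟩` for all `|ψ⟩` in `C`, with `c` depending on `E` only. -/
def Detects {α : Type} [Fintype α] [DecidableEq α] {n : ℕ}
    (C : Submodule ℂ ((Fin n → α) → ℂ)) (t : ℕ) : Prop :=
  ∀ s ≤ t, ∀ (e : Fin s ↪ Fin n) (E : Matrix (Fin s → α) (Fin s → α) ℂ),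
    ∃ c : ℂ, ∀ φ ∈ C, ∀ ψ ∈ C, star φ ⬝ᵥ (actOn e E *ᵥ ψ) = c * (star φ ⬝ᵥ ψ)

/-- Decoding operations for the stabilizer code with generators `M`: for every syndrome `s`, a
unitary that carries the syndrome space of `s` into `|data⟩ ⊗ |0 ⋯ 0⟩`, where the data are held
by the first `k` qudits. -/
def IsDecoding {d n r : ℕ} [NeZero d] (M : Fin r → Matrix (Fin n → ZMod d) (Fin n → ZMod d) ℂ)
    (k : ℕ) (D : (Fin r → ZMod d) → Matrix (Fin n → ZMod d) (Fin n → ZMod d) ℂ) : Prop :=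
  ∀ s, D s ∈ Matrix.unitaryGroup (Fin n → ZMod d) ℂ ∧
    ∀ ψ ∈ syndromeSpace M s, ∀ j : Fin n → ZMod d,
      (∃ i : Fin n, k ≤ i.val ∧ j i ≠ 0) → (D s *ᵥ ψ) j = 0

end Pauli

/-! ### Two-way entanglement purification

A state of `n` pairs is a density matrix indexed by `Fin n → α × α`; in every pair Alice holds the
first half and Bob the second half. -/

/-- The local operation `A ⊗ B`: `A` on Alice's halves, `B` on Bob's halves. -/
def localOp {α : Type} {n : ℕ} (A B : Matrix (Fin n → α) (Fin n → α) ℂ) :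
    Matrix (Fin n → α × α) (Fin n → α × α) ℂ :=
  Matrix.of fun x y =>
    A (fun i => (x i).1) (fun i => (y i).1) * B (fun i => (x i).2) (fun i => (y i).2)

/-- The density matrix of `n` perfect EPR pairs, each in the state `d^(-1/2) ∑ j, |j⟩|j⟩`. -/
noncomputable def eprPairs (α : Type) [Fintype α] [DecidableEq α] (n : ℕ) :
    Matrix (Fin n → α × α) (Fin n → α × α) ℂ :=
  Matrix.of fun x y =>
    if (∀ i, (x i).1 = (x i).2) ∧ (∀ i, (y i).1 = (y i).2)
    then ((Fintype.card α : ℂ) ^ n)⁻¹ else 0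

/-- Keep the systems `keep 0, …, keep (k - 1)` and discard (trace out) all the others. -/
def discardRest {β : Type} [Fintype β] [DecidableEq β] {n k : ℕ} (keep : Fin k ↪ Fin n)
    (ρ : Matrix (Fin n → β) (Fin n → β) ℂ) : Matrix (Fin k → β) (Fin k → β) ℂ :=
  Matrix.of fun u v => ∑ x, ∑ y,
    if (∀ i, x (keep i) = u i) ∧ (∀ i, y (keep i) = v i) ∧
      (∀ j, (∀ i, keep i ≠ j) → x j = y j) then ρ x y else 0

/-- The projector onto the eigenspace of `M` with eigenvalue `ω ^ a`, for unitary `M` with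
`M ^ d = 1`. -/
noncomputable def eigenProj {d n : ℕ} [NeZero d] (M : Matrix (Fin n → ZMod d) (Fin n → ZMod d) ℂ)
    (a : ZMod d) : Matrix (Fin n → ZMod d) (Fin n → ZMod d) ℂ :=
  (d : ℂ)⁻¹ • ∑ j ∈ Finset.range d, (omega d)⁻¹ ^ (a.val * j) • M ^ j

/-- Two-way protocols on `n` pairs of qudits with `k` output pairs. In a step `measure M next`
Alice and Bob each measure `M` on their own halves, with outcomes `a` (Alice) and `b` (Bob), send
each other the outcomes, and go on with `next a b`. In `finish UA UB keep` they apply the local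
unitaries `UA` and `UB`, keep the pairs listed by `keep`, and discard the others. -/
inductive Protocol (d n k : ℕ) : Type
  | finish (UA UB : Matrix (Fin n → ZMod d) (Fin n → ZMod d) ℂ) (keep : Fin k ↪ Fin n) :
      Protocol d n k
  | measure (M : Matrix (Fin n → ZMod d) (Fin n → ZMod d) ℂ)
      (next : ZMod d → ZMod d → Protocol d n k) : Protocol d n k

namespace Protocol

variable {d n k : ℕ} [NeZero d]

/-- The rules of a 2-EPP, once the operators in `prev` have been measured: every measured operator
is a Pauli operator with eigenvalues powers of `ω` and commutes with all the operators measured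
before, and the final local operations are unitary. -/
def ValidAfter : List (Matrix (Fin n → ZMod d) (Fin n → ZMod d) ℂ) → Protocol d n k → Prop
  | _, .finish UA UB _ =>
      UA ∈ Matrix.unitaryGroup (Fin n → ZMod d) ℂ ∧ UB ∈ Matrix.unitaryGroup (Fin n → ZMod d) ℂ
  | prev, .measure M next =>
      M ∈ pauliGroup d n ∧ M ^ d = 1 ∧ (∀ N ∈ prev, Commute M N) ∧
        ∀ a b, ValidAfter (M :: prev) (next a b)

/-- The protocol is a 2-EPP (of stabilizer type). -/
def IsTwoEPP (P : Protocol d n k) : Prop := ValidAfter [] P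

/-- The final state of the `k` kept pairs, on input `ρ`: the sum over all measurement outcomes of
the final states, each weighted with the probability of the outcomes. -/
noncomputable def run : Protocol d n k → Matrix (Fin n → ZMod d × ZMod d) (Fin n → ZMod d × ZMod d) ℂ →
    Matrix (Fin k → ZMod d × ZMod d) (Fin k → ZMod d × ZMod d) ℂ
  | .finish UA UB keep, ρ => discardRest keep (localOp UA UB * ρ * (localOp UA UB)ᴴ)
  | .measure M next, ρ => ∑ a, ∑ b, run (next a b)
      (localOp (eigenProj M a) (eigenProj M b) * ρ * (localOp (eigenProj M a) (eigenProj M b))ᴴ)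

/-- The protocol corrects `t` errors: whenever an arbitrary channel has acted on at most `t` of
`n` EPR pairs, the protocol produces exactly `k` perfect EPR pairs. The channel may act on both
halves of the affected pairs; in particular it may act on Bob's halves only. As perfect EPR pairs
are in a pure state, the average `run` over the measurement outcomes is that state if and only if
the final state is that state for all outcomes of positive probability. -/
def Corrects (P : Protocol d n k) (t : ℕ) : Prop :=
  ∀ s ≤ t, ∀ (e : Fin s ↪ Fin n)
    (N : Channel (Fin s → ZMod d × ZMod d) (Fin s → ZMod d × ZMod d)),
    P.run (N.applyOn e (eprPairs (ZMod d) n)) = eprPairs (ZMod d) k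

end Protocol

/-! ### The four-pair protocol -/

/-- The generators `X ⊗ X ⊗ X` and `Z ⊗ Z ⊗ Z` of the three-qutrit stabilizer. -/
noncomputable def threeQutritGenerators :
    Fin 2 → Matrix (Fin 3 → ZMod 3) (Fin 3 → ZMod 3) ℂ :=
  ![tensor ![shiftX 3, shiftX 3, shiftX 3], tensor ![clockZ 3, clockZ 3, clockZ 3]]

/-- The coding space of the three-qutrit stabilizer. -/
noncomputable def threeQutritCode : Submodule ℂ ((Fin 3 → ZMod 3) → ℂ) :=
  syndromeSpace threeQutritGenerators 0

/-- The first three of four pairs. -/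
def firstThree : Fin 3 ↪ Fin 4 := Fin.castSuccEmb

/-- The single pair number `i` (counted from `0`) out of four. -/
def onlyPair (i : Fin 4) : Fin 1 ↪ Fin 4 := ⟨fun _ => i, fun _ _ _ => Subsingleton.elim _ _⟩

/-- Alice and Bob measure `X ⊗ X ⊗ X` and `Z ⊗ Z ⊗ Z` on the first three pairs, with outcomes
`ω ^ a₁, ω ^ a₂` for Alice and `ω ^ b₁, ω ^ b₂` for Bob. Without errors `b₁ = -a₁` and `b₂ = a₂`,
since an EPR pair is fixed by `X ⊗ X` and by `Z ⊗ Z⁻¹`. If the outcomes obey this (no error is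
detected), Alice and Bob decode the first three pairs according to their own syndromes and keep
the one decoded pair; otherwise they keep the fourth pair. -/
noncomputable def fourPairProtocol
    (DA DB : (Fin 2 → ZMod 3) → Matrix (Fin 3 → ZMod 3) (Fin 3 → ZMod 3) ℂ) : Protocol 3 4 1 :=
  .measure (tensor ![shiftX 3, shiftX 3, shiftX 3, 1]) fun a₁ b₁ =>
  .measure (tensor ![clockZ 3, clockZ 3, clockZ 3, 1]) fun a₂ b₂ =>
    if a₁ + b₁ = 0 ∧ a₂ = b₂ then
      .finish (actOn firstThree (DA ![a₁, a₂])) (actOn firstThree (DB ![b₁, b₂])) (onlyPair 0)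
    else .finish 1 1 (onlyPair 3)

end QuditEPP

namespace QuditEPP

/-! ### Ranks of the flattenings of a tensor -/

section Ranks

open Module
open scoped ComplexOrder

/-! Singleton bound. Split the systems into `A` and `B`, each a union of two blocks of at most `t`
systems, and a remainder `C`; with an index `R` for the encoded basis the encoder becomes a tensor
ψ(a,b,c,r). Exact correction on both blocks of `A` gives the Knill-Laflamme condition for products
of matrix units on the blocks (`QECC.Corrects.knillLaflamme`), hence for all operators on `A`: the
reduced matrix of `A` and `R` is ρ ⊗ 1. Ranks then do the work of entropies: |R|·rk(A) ≤ rk(AR) =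
rk(BC) ≤ |C|·rk(B), and likewise with `A` and `B` exchanged. The ranks are positive, so |R| ≤ |C|
(`card_le_card_of_uncorrelated`), which reads d^k ≤ d^(n-4t) when 4t ≤ n.

Detection. Vectors of a given syndrome are supported on a fixed value of ∑ x_i, so only the diagonal
of a one-qutrit operator E contributes. The product of a conjugated and an unconjugated such vector
is invariant under x ↦ x + 1, so the diagonal is averaged to tr E / 3 (`exists_detection_constant`).

The protocol. Write an unnormalised pure state of pairs as a matrix Ψ, Alice indexing rows and Bob
columns. Local operations send Ψ to A Ψ Bᵀ, perfect pairs are a multiple of 1, and each Kraus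
operator of an error leaves κ ⊗ 1, with κ on the affected systems (`exists_applyOn_eprPairs`).
Measuring gives P_a (κ ⊗ 1) P_b, where Bob's X-outcome enters with a minus sign because Xᵀ = X⁻¹. If
a = b, an error in the first three pairs satisfies P_a κ P_a = c P_a by detection, and decoding
yields a perfect pair; an error in the fourth pair is discarded. If a ≠ b, an error in the fourth
pair alone would give P_a P_b = 0, so the fourth pair is intact. Every branch is thus a multiple of
the perfect pair. The protocol is linear and preserves the trace, so the total is exactly that pair.
-/

theorem finrank_submodule_pi {ι V : Type*} [Fintype ι] [AddCommGroup V] [Module ℂ V]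
    [FiniteDimensional ℂ V] (W : Submodule ℂ V) :
    finrank ℂ (Submodule.pi Set.univ fun _ : ι => W) = Fintype.card ι * finrank ℂ W := by
  have h := LinearMap.range_compLeft W.subtype ι
  rw [Submodule.range_subtype] at h
  rw [← h, LinearMap.finrank_range_of_inj, finrank_pi_fintype]
  · simp
  · intro x y hxy
    funext i
    exact Subtype.ext (congrFun hxy i)

/-- The rank of `1 ⊗ ρ` is at least the size of `1` times the rank of `ρ`. -/
theorem card_mul_rank_le_rank {R A : Type*} [Fintype R] [Fintype A] [DecidableEq R]
    (ρ : Matrix A A ℂ) (K : Matrix (R × A) (R × A) ℂ)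
    (hK : ∀ r a r' a', K (r, a) (r', a') = if r = r' then ρ a a' else 0) :
    Fintype.card R * ρ.rank ≤ K.rank := by
  have h : Submodule.pi Set.univ (fun _ : R => LinearMap.range ρ.mulVecLin) ≤
      (LinearMap.range K.mulVecLin).map (LinearEquiv.curry ℂ ℂ R A).toLinearMap := by
    rw [← LinearMap.range_compLeft]
    rintro _ ⟨v, rfl⟩
    -- Since `K` is block diagonal, a family of vectors ρ v_r, one for each r, is the image of the
    -- single vector (r, a) ↦ v_r(a).
    refine ⟨K *ᵥ (fun p => v p.1 p.2), ⟨_, rfl⟩, ?_⟩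
    ext r a
    simp [Matrix.mulVec, dotProduct, Fintype.sum_prod_type, hK]
  have h2 := Submodule.finrank_mono h
  rw [finrank_submodule_pi, LinearEquiv.finrank_map_eq] at h2
  exact h2

/-- A matrix with rows indexed by `C × B` whose blocks of rows all have columns in the range of
`L` has rank at most the number of blocks times the rank of `L`. -/
theorem rank_le_card_mul_rank {C B X Y : Type*} [Fintype C] [Fintype B] [Fintype X] [Fintype Y]
    (M : Matrix (C × B) X ℂ) (L : Matrix B Y ℂ)
    (h : ∀ c x, (fun b => M (c, b) x) ∈ LinearMap.range L.mulVecLin) :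
    M.rank ≤ Fintype.card C * L.rank := by
  have h1 : (LinearMap.range M.mulVecLin).map (LinearEquiv.curry ℂ ℂ C B).toLinearMap ≤
      Submodule.pi Set.univ (fun _ : C => LinearMap.range L.mulVecLin) := by
    rintro _ ⟨_, ⟨v, rfl⟩, rfl⟩ c -
    have : (LinearEquiv.curry ℂ ℂ C B) (M *ᵥ v) c = ∑ x, v x • fun b => M (c, b) x := by
      ext b
      simp [Matrix.mulVec, dotProduct, mul_comm]
    simp only [LinearEquiv.coe_coe, Matrix.mulVecLin_apply, this]
    exact Submodule.sum_mem _ fun x _ => Submodule.smul_mem _ _ (h c x)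
  have h2 := Submodule.finrank_mono h1
  rw [finrank_submodule_pi, LinearEquiv.finrank_map_eq] at h2
  exact h2

/-- The rank of the flattening of the tensor `ψ` that separates the index `A`. -/
noncomputable def flatRank {A B C R : Type*} [Fintype B] [Fintype C] [Fintype R]
    (ψ : A → B → C → R → ℂ) : ℕ :=
  (Matrix.of fun (a : A) (p : B × C × R) => ψ a p.1 p.2.1 p.2.2).rank

/-- If the index `A` is uncorrelated with the index `R`, then the rank of the flattening that
separates `A` and `R` from `B` and `C` is multiplicative; it is submultiplicative in `B`, `C`. -/
theorem card_mul_flatRank_le {A B C R : Type*} [Fintype A] [Fintype B] [Fintype C] [Fintype R]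
    [DecidableEq R] (ψ : A → B → C → R → ℂ) (ρ : Matrix A A ℂ)
    (h : ∀ a a' r r', ∑ b, ∑ c, ψ a b c r * star (ψ a' b c r') = if r = r' then ρ a a' else 0) :
    Fintype.card R * flatRank ψ ≤ Fintype.card C * flatRank (fun b a c r => ψ a b c r) := by
  set M : Matrix (R × A) (C × B) ℂ := Matrix.of fun p q => ψ p.2 q.2 q.1 p.1 with hM
  have h1 : Fintype.card R * ρ.rank ≤ (M * Mᴴ).rank := by
    refine card_mul_rank_le_rank ρ _ fun r a r' a' => ?_
    rw [← h, Matrix.mul_apply, Fintype.sum_prod_type, Finset.sum_comm]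
    rfl
  have h2 : M.rank ≤ Fintype.card C * flatRank (fun b a c r => ψ a b c r) := by
    rw [← Matrix.rank_transpose]
    refine rank_le_card_mul_rank _ _ fun c x => ?_
    classical
    -- For x = (r, a), the block `c` is the column (a, c, r) of the flattening that separates `B`.
    refine ⟨Pi.single (x.2, c, x.1) 1, ?_⟩
    ext b
    simp [hM]
  rw [Matrix.rank_self_mul_conjTranspose] at h1
  refine le_trans ?_ (h1.trans h2)
  rcases isEmpty_or_nonempty R with hR | hR
  · simp
  refine Nat.mul_le_mul_left _ ?_
  -- Summing the diagonal blocks r = r' of `h` gives the Gram matrix of the flattening. As `R` is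
  -- nonempty the factor |R| is non-zero, so the flattening has the rank of ρ.
  have h3 : (Matrix.of fun (a : A) (p : B × C × R) => ψ a p.1 p.2.1 p.2.2) *
      (Matrix.of fun (a : A) (p : B × C × R) => ψ a p.1 p.2.1 p.2.2)ᴴ
      = (Fintype.card R : ℂ) • ρ := by
    ext a a'
    have h4 : ∀ r, ∑ b, ∑ c, ψ a b c r * star (ψ a' b c r) = ρ a a' := fun r => by rw [h, if_pos rfl]
    simp only [Matrix.mul_apply, Fintype.sum_prod_type, Matrix.of_apply,
      Matrix.conjTranspose_apply, Matrix.smul_apply, smul_eq_mul]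
    have : ∀ b, ∑ c, ∑ r, ψ a b c r * star (ψ a' b c r) =
        ∑ r, ∑ c, ψ a b c r * star (ψ a' b c r) := fun b => Finset.sum_comm
    rw [Finset.sum_congr rfl fun b _ => this b, Finset.sum_comm]
    rw [Finset.sum_congr rfl fun r _ => h4 r, Finset.sum_const, nsmul_eq_mul, Finset.card_univ]
  rw [flatRank, ← Matrix.rank_self_mul_conjTranspose, h3, Matrix.rank_smul_of_mem_nonZeroDivisors]
  simp

theorem flatRank_pos {A B C R : Type*} [Fintype A] [Fintype B] [Fintype C] [Fintype R]
    (ψ : A → B → C → R → ℂ) (h : ∃ a b c r, ψ a b c r ≠ 0) : 0 < flatRank ψ := by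
  obtain ⟨a, b, c, r, h⟩ := h
  rw [Nat.pos_iff_ne_zero, flatRank, Matrix.rank, Ne, Submodule.finrank_eq_zero,
    LinearMap.range_eq_bot]
  intro h0
  classical
  refine h ?_
  simpa using congrFun (LinearMap.congr_fun h0 (Pi.single (b, c, r) 1)) a

/-- If `A` and `B` are both uncorrelated with `R` in the non-zero tensor `ψ`, then `R` is not
larger than `C`. -/
theorem card_le_card_of_uncorrelated {A B C R : Type*} [Fintype A] [Fintype B] [Fintype C]
    [Fintype R] [DecidableEq R] (ψ : A → B → C → R → ℂ) (hψ : ∃ a b c r, ψ a b c r ≠ 0)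
    (hA : ∀ a a', ∃ z, ∀ r r', ∑ b, ∑ c, ψ a b c r * star (ψ a' b c r') = if r = r' then z else 0)
    (hB : ∀ b b', ∃ z, ∀ r r', ∑ a, ∑ c, ψ a b c r * star (ψ a b' c r') = if r = r' then z else 0) :
    Fintype.card R ≤ Fintype.card C := by
  choose ρ hρ using hA
  choose σ hσ using hB
  have h1 := card_mul_flatRank_le ψ (Matrix.of ρ) hρ
  have h2 := card_mul_flatRank_le (fun b a c r => ψ a b c r) (Matrix.of σ) hσ
  have h3 := flatRank_pos ψ hψ
  have h4 : 0 < flatRank (fun b a c r => ψ a b c r) := by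
    obtain ⟨a, b, c, r, h⟩ := hψ
    exact flatRank_pos _ ⟨b, a, c, r, h⟩
  -- If |C| < |R|, then |C|·rk(A) < |R|·rk(A) ≤ |C|·rk(B) < |R|·rk(B) ≤ |C|·rk(A).
  by_contra! hlt
  nlinarith [Nat.mul_lt_mul_of_pos_right hlt h3, Nat.mul_lt_mul_of_pos_right hlt h4]

end Ranks

/-! ### Operators on some of the systems -/

section ActOn

variable {α : Type} {m n : ℕ}

/-- `x` and `y` agree outside of the range of `e`. -/
def AgreeOff (e : Fin m ↪ Fin n) (x y : Fin n → α) : Prop :=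
  ∀ i, (∀ j, e j ≠ i) → x i = y i

instance [DecidableEq α] (e : Fin m ↪ Fin n) (x y : Fin n → α) : Decidable (AgreeOff e x y) :=
  inferInstanceAs (Decidable (∀ i, (∀ j, e j ≠ i) → x i = y i))

/-- The configuration `x` with its values on the range of `e` replaced by `p`. -/
noncomputable def overwrite (e : Fin m ↪ Fin n) (p : Fin m → α) (x : Fin n → α) : Fin n → α :=
  Function.extend e p x

theorem overwrite_apply (e : Fin m ↪ Fin n) (p : Fin m → α) (x : Fin n → α) (j : Fin m) :
    overwrite e p x (e j) = p j := e.injective.extend_apply _ _ _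

theorem overwrite_apply_of_ne (e : Fin m ↪ Fin n) (p : Fin m → α) (x : Fin n → α) {i : Fin n}
    (h : ∀ j, e j ≠ i) : overwrite e p x i = x i :=
  Function.extend_apply' _ _ _ fun ⟨j, hj⟩ => h j hj

theorem AgreeOff.symm {e : Fin m ↪ Fin n} {x y : Fin n → α} (h : AgreeOff e x y) :
    AgreeOff e y x := fun i hi => (h i hi).symm

theorem agreeOff_comm {e : Fin m ↪ Fin n} {x y : Fin n → α} :
    AgreeOff e x y ↔ AgreeOff e y x := ⟨AgreeOff.symm, AgreeOff.symm⟩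

theorem AgreeOff.overwrite_eq {e : Fin m ↪ Fin n} {x y : Fin n → α} (h : AgreeOff e x y) :
    overwrite e (fun j => y (e j)) x = y := by
  funext i
  by_cases hi : ∃ j, e j = i
  · obtain ⟨j, rfl⟩ := hi
    rw [overwrite_apply]
  · push Not at hi
    rw [overwrite_apply_of_ne _ _ _ hi, h i hi]

theorem agreeOff_overwrite (e : Fin m ↪ Fin n) (p : Fin m → α) (x : Fin n → α) :
    AgreeOff e x (overwrite e p x) := fun _ hi => (overwrite_apply_of_ne e p x hi).symm

theorem agreeOff_overwrite_left (e : Fin m ↪ Fin n) (p : Fin m → α) (x y : Fin n → α) :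
    AgreeOff e (overwrite e p x) y ↔ AgreeOff e x y :=
  forall₂_congr fun _ hi => by rw [overwrite_apply_of_ne e p x hi]

theorem AgreeOff.eq {e : Fin m ↪ Fin n} {x y : Fin n → α} (h : AgreeOff e x y)
    (h' : ∀ j, x (e j) = y (e j)) : x = y := by
  funext i
  by_cases hi : ∃ j, e j = i
  · obtain ⟨j, rfl⟩ := hi
    exact h' j
  · push Not at hi
    exact h i hi

variable [DecidableEq α]

theorem actOn_apply (e : Fin m ↪ Fin n) (K : Matrix (Fin m → α) (Fin m → α) ℂ) (x y : Fin n → α) :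
    actOn e K x y = if AgreeOff e x y then K (fun j => x (e j)) (fun j => y (e j)) else 0 := rfl

/-- The configurations agreeing with `x` off the range of `e` are the overwrites of `x`, one for
each local configuration. This reduces products with `actOn` to sums over the systems acted on. -/
theorem sum_agreeOff [Fintype α] {M : Type*} [AddCommMonoid M] (e : Fin m ↪ Fin n)
    (x : Fin n → α) (f : (Fin n → α) → M) :
    ∑ y, (if AgreeOff e x y then f y else 0) = ∑ p, f (overwrite e p x) := by
  rw [← Finset.sum_filter]
  refine Finset.sum_bij' (fun y _ j => y (e j)) (fun p _ => overwrite e p x) ?_ ?_ ?_ ?_ ?_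
  · simp
  · simp [agreeOff_overwrite]
  · intro y hy
    exact (Finset.mem_filter.1 hy).2.overwrite_eq
  · intro p _
    funext j
    exact overwrite_apply e p x j
  · intro y hy
    rw [(Finset.mem_filter.1 hy).2.overwrite_eq]

theorem sum_actOn_mul [Fintype α] (e : Fin m ↪ Fin n) (K : Matrix (Fin m → α) (Fin m → α) ℂ)
    (x : Fin n → α) (f : (Fin n → α) → ℂ) :
    ∑ y, actOn e K x y * f y = ∑ p, K (fun j => x (e j)) p * f (overwrite e p x) := by
  simp_rw [actOn_apply, ite_mul, zero_mul]
  rw [sum_agreeOff]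
  simp_rw [overwrite_apply]

theorem actOn_mul [Fintype α] (e : Fin m ↪ Fin n) (K L : Matrix (Fin m → α) (Fin m → α) ℂ) :
    actOn e (K * L) = actOn e K * actOn e L := by
  ext x z
  rw [Matrix.mul_apply, sum_actOn_mul]
  simp_rw [actOn_apply, agreeOff_overwrite_left, overwrite_apply, mul_ite, mul_zero]
  split_ifs
  · rw [Matrix.mul_apply]
  · simp

theorem actOn_one (e : Fin m ↪ Fin n) : actOn (α := α) e 1 = 1 := by
  ext x y
  rw [actOn_apply, Matrix.one_apply, Matrix.one_apply]
  by_cases hxy : x = y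
  · subst hxy
    simp [AgreeOff]
  · rw [if_neg hxy]
    split_ifs with h h'
    · exact absurd (h.eq (congrFun h')) hxy
    · rfl
    · rfl

theorem actOn_smul (e : Fin m ↪ Fin n) (c : ℂ) (K : Matrix (Fin m → α) (Fin m → α) ℂ) :
    actOn e (c • K) = c • actOn e K := by
  ext x y
  simp [actOn_apply]

theorem actOn_zero (e : Fin m ↪ Fin n) :
    actOn e (0 : Matrix (Fin m → α) (Fin m → α) ℂ) = 0 := by
  ext x y
  simp [actOn_apply]

theorem actOn_sum {ι : Type*} (s : Finset ι) (e : Fin m ↪ Fin n)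
    (K : ι → Matrix (Fin m → α) (Fin m → α) ℂ) :
    actOn e (∑ i ∈ s, K i) = ∑ i ∈ s, actOn e (K i) := by
  ext x y
  simp only [actOn_apply, Matrix.sum_apply]
  split_ifs <;> simp

theorem actOn_pow [Fintype α] (e : Fin m ↪ Fin n) (K : Matrix (Fin m → α) (Fin m → α) ℂ) (j : ℕ) :
    actOn e (K ^ j) = actOn e K ^ j := by
  induction j with
  | zero => simp [actOn_one]
  | succ j ih => rw [pow_succ, pow_succ, actOn_mul, ih]

theorem actOn_transpose (e : Fin m ↪ Fin n) (K : Matrix (Fin m → α) (Fin m → α) ℂ) :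
    actOn e Kᵀ = (actOn e K)ᵀ := by
  ext x y
  simp [actOn_apply, agreeOff_comm (x := x)]

theorem actOn_conjTranspose (e : Fin m ↪ Fin n) (K : Matrix (Fin m → α) (Fin m → α) ℂ) :
    actOn e Kᴴ = (actOn e K)ᴴ := by
  ext x y
  simp only [actOn_apply, agreeOff_comm (x := x), Matrix.conjTranspose_apply]
  split_ifs <;> simp

theorem actOn_actOn {l : ℕ} (e : Fin l ↪ Fin m) (f : Fin m ↪ Fin n)
    (K : Matrix (Fin l → α) (Fin l → α) ℂ) :
    actOn f (actOn e K) = actOn (e.trans f) K := by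
  ext x y
  have : (AgreeOff f x y ∧ AgreeOff e (fun j => x (f j)) fun j => y (f j)) ↔
      AgreeOff (e.trans f) x y := by
    constructor
    · rintro ⟨h1, h2⟩ i hi
      by_cases hf : ∃ j, f j = i
      · obtain ⟨j, rfl⟩ := hf
        exact h2 j fun k hk => hi k (by simp [hk])
      · push Not at hf
        exact h1 i hf
    · intro h
      refine ⟨fun i hi => h i fun j => hi _, fun i hi => h _ fun j hj => hi j (f.injective hj)⟩
  simp only [actOn_apply, ← ite_and, this]
  rfl

/-- The entries of a product of operators on disjoint sets of systems. -/
theorem actOn_mul_actOn_apply [Fintype α] {l : ℕ} (e : Fin m ↪ Fin n) (f : Fin l ↪ Fin n)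
    (h : ∀ i j, e i ≠ f j) (K : Matrix (Fin m → α) (Fin m → α) ℂ)
    (L : Matrix (Fin l → α) (Fin l → α) ℂ) (x z : Fin n → α) :
    (actOn e K * actOn f L) x z =
      if ∀ i, (∀ j, e j ≠ i) → (∀ j, f j ≠ i) → x i = z i then
        K (fun j => x (e j)) (fun j => z (e j)) * L (fun j => x (f j)) (fun j => z (f j))
      else 0 := by
  rw [Matrix.mul_apply, sum_actOn_mul]
  have h1 : ∀ p, AgreeOff f (overwrite e p x) z ↔ p = (fun j => z (e j)) ∧
      ∀ i, (∀ j, e j ≠ i) → (∀ j, f j ≠ i) → x i = z i := by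
    intro p
    constructor
    · intro hp
      refine ⟨funext fun j => ?_, fun i hi hi' => ?_⟩
      · rw [← hp (e j) fun k hk => h j k hk.symm, overwrite_apply]
      · rw [← hp i hi', overwrite_apply_of_ne _ _ _ hi]
    · rintro ⟨rfl, hp⟩ i hi
      by_cases he : ∃ j, e j = i
      · obtain ⟨j, rfl⟩ := he
        rw [overwrite_apply]
      · push Not at he
        rw [overwrite_apply_of_ne _ _ _ he, hp i he hi]
  have h2 : ∀ p j, overwrite e p x (f j) = x (f j) := fun p j =>
    overwrite_apply_of_ne _ _ _ fun i => h i j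
  simp only [actOn_apply, h1, h2, ite_and, mul_ite, mul_zero, Finset.sum_ite_eq', Finset.mem_univ,
    if_true]

theorem actOn_commute [Fintype α] {l : ℕ} (e : Fin m ↪ Fin n) (f : Fin l ↪ Fin n)
    (h : ∀ i j, e i ≠ f j) (K : Matrix (Fin m → α) (Fin m → α) ℂ)
    (L : Matrix (Fin l → α) (Fin l → α) ℂ) :
    actOn e K * actOn f L = actOn f L * actOn e K := by
  ext x z
  rw [actOn_mul_actOn_apply e f h, actOn_mul_actOn_apply f e fun i j => (h j i).symm, mul_comm]
  have : (∀ i, (∀ j, e j ≠ i) → (∀ j, f j ≠ i) → x i = z i) ↔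
      (∀ i, (∀ j, f j ≠ i) → (∀ j, e j ≠ i) → x i = z i) :=
    forall_congr' fun i => ⟨fun h a b => h b a, fun h a b => h b a⟩
  simp only [this]

theorem actOn_mem_unitaryGroup [Fintype α] (e : Fin m ↪ Fin n)
    {U : Matrix (Fin m → α) (Fin m → α) ℂ} (hU : U ∈ Matrix.unitaryGroup (Fin m → α) ℂ) :
    actOn e U ∈ Matrix.unitaryGroup (Fin n → α) ℂ := by
  rw [Matrix.mem_unitaryGroup_iff, Matrix.star_eq_conjTranspose] at *
  rw [← actOn_conjTranspose, ← actOn_mul, hU, actOn_one]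

/-- A channel on some of the systems preserves the trace. -/
theorem Channel.trace_applyOn [Fintype α] (N : Channel (Fin m → α) (Fin m → α)) (e : Fin m ↪ Fin n)
    (ρ : Matrix (Fin n → α) (Fin n → α) ℂ) : (N.applyOn e ρ).trace = ρ.trace := by
  rw [Channel.applyOn, Matrix.trace_sum]
  simp_rw [Matrix.trace_mul_cycle _ ρ]
  rw [← Matrix.trace_sum, ← Finset.sum_mul]
  simp_rw [← actOn_conjTranspose, ← actOn_mul]
  rw [← actOn_sum, N.trace_preserving, actOn_one, one_mul]

end ActOn

/-! ### The quantum Singleton bound -/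

section Singleton

/-- The Kraus operators of the identity channel are scalars. -/
theorem kraus_eq_smul_one {ι R : Type*} [Fintype ι] [Fintype R] [DecidableEq R]
    (K : ι → Matrix R R ℂ) (h : ∀ ρ : Matrix R R ℂ, ∑ i, K i * ρ * (K i)ᴴ = ρ) (i : ι) :
    ∃ c : ℂ, K i = c • (1 : Matrix R R ℂ) := by
  have h1 : ∀ x x' y y', ∑ i, K i y x * star (K i y' x') = if x = y ∧ x' = y' then 1 else 0 := by
    intro x x' y y'
    have := congrFun (congrFun (h (Matrix.single x x' 1)) y) y'
    rw [Matrix.single_apply, Matrix.sum_apply] at this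
    rw [← this]
    refine Finset.sum_congr rfl fun i _ => ?_
    rw [Matrix.mul_apply, Finset.sum_eq_single x']
    · rw [Matrix.mul_single_apply_same, mul_one, Matrix.conjTranspose_apply]
    · intro b _ hb
      rw [Matrix.mul_single_apply_of_ne _ _ _ _ _ hb, zero_mul]
    · simp
  have h2 : ∀ f : ι → ℂ, ∑ i, f i * star (f i) = 0 → f i = 0 := by
    intro f hf
    have h3 : ∑ i, ‖f i‖ ^ 2 = 0 := by
      have : ((∑ i, ‖f i‖ ^ 2 : ℝ) : ℂ) = 0 := by
        rw [← hf]
        push_cast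
        exact Finset.sum_congr rfl fun i _ => (Complex.mul_conj' _).symm
      exact_mod_cast this
    have := (Finset.sum_eq_zero_iff_of_nonneg fun i _ => by positivity).1 h3 i (Finset.mem_univ i)
    simpa using this
  rcases isEmpty_or_nonempty R with hR | ⟨⟨r⟩⟩
  · exact ⟨0, Subsingleton.elim _ _⟩
  refine ⟨K i r r, ?_⟩
  ext y x
  rw [Matrix.smul_apply, Matrix.one_apply]
  by_cases hxy : y = x
  · subst hxy
    rw [if_pos rfl, smul_eq_mul, mul_one, ← sub_eq_zero]
    -- By `h1` the sum of the squared moduli expands to 1 - 1 - 1 + 1 = 0.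
    refine h2 (fun i => K i y y - K i r r) ?_
    simp only [star_sub, mul_sub, sub_mul, Finset.sum_sub_distrib, h1]
    simp
  · rw [if_neg hxy, smul_zero]
    refine h2 (fun i => K i y x) ?_
    rw [h1, if_neg fun h => hxy h.1.symm]

/-- The completely depolarizing channel; its Kraus operators are multiples of the matrix units. -/
noncomputable def depolarizing (P : Type) [Fintype P] [DecidableEq P] [Nonempty P] :
    Channel P P where
  r := Fintype.card (P × P)
  kraus i := ((√(Fintype.card P : ℝ) : ℝ) : ℂ)⁻¹ •
    Matrix.single ((Fintype.equivFin (P × P)).symm i).1 ((Fintype.equivFin (P × P)).symm i).2 1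
  trace_preserving := by
    rw [Equiv.sum_comp (Fintype.equivFin (P × P)).symm fun p =>
      (((√(Fintype.card P : ℝ) : ℝ) : ℂ)⁻¹ • Matrix.single p.1 p.2 (1 : ℂ))ᴴ *
        (((√(Fintype.card P : ℝ) : ℝ) : ℂ)⁻¹ • Matrix.single p.1 p.2 (1 : ℂ))]
    have h0 : (Fintype.card P : ℂ) ≠ 0 := by simp
    have h1 : ((√(Fintype.card P : ℝ) : ℝ) : ℂ)⁻¹ * ((√(Fintype.card P : ℝ) : ℝ) : ℂ)⁻¹ =
        (Fintype.card P : ℂ)⁻¹ := by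
      rw [← mul_inv, ← Complex.ofReal_mul, Real.mul_self_sqrt (by positivity)]
      simp
    have h2 : ∀ p : P × P, (((√(Fintype.card P : ℝ) : ℝ) : ℂ)⁻¹ • Matrix.single p.1 p.2 (1 : ℂ))ᴴ *
        (((√(Fintype.card P : ℝ) : ℝ) : ℂ)⁻¹ • Matrix.single p.1 p.2 (1 : ℂ)) =
        (Fintype.card P : ℂ)⁻¹ • Matrix.single p.2 p.2 (1 : ℂ) := by
      intro p
      rw [Matrix.conjTranspose_smul, Matrix.smul_mul, Matrix.mul_smul, smul_smul,
        Matrix.conjTranspose_single, Matrix.single_mul_single_same]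
      simp [h1]
    rw [Finset.sum_congr rfl fun p _ => h2 p, Fintype.sum_prod_type]
    simp only [Finset.sum_const, ← Finset.smul_sum, Finset.card_univ]
    rw [Matrix.sum_single_one, ← Nat.cast_smul_eq_nsmul ℂ, smul_smul, mul_inv_cancel₀ h0, one_smul]

theorem depolarizing_kraus {P : Type} [Fintype P] [DecidableEq P] [Nonempty P] (p q : P) :
    (depolarizing P).kraus (Fintype.equivFin (P × P) (p, q)) =
      ((√(Fintype.card P : ℝ) : ℝ) : ℂ)⁻¹ • Matrix.single p q 1 := by
  simp [depolarizing]

variable {α : Type} [Fintype α] [DecidableEq α] [Nonempty α] {n k : ℕ}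

/-- Each Kraus operator of the decoder acts as a scalar on encoded states with correctable
errors. -/
theorem QECC.Corrects.decoder_mul {C : QECC α n k} {t s : ℕ} (hC : C.Corrects t) (hs : s ≤ t)
    (e : Fin s ↪ Fin n) (p q : Fin s → α) (j : Fin C.decoder.r) :
    ∃ c : ℂ, C.decoder.kraus j * actOn e (Matrix.single p q 1) * C.encoder =
      c • (1 : Matrix (Fin k → α) (Fin k → α) ℂ) := by
  -- The Kraus operators of this one channel are multiples of all matrix units, so a single instance
  -- of correctability handles every elementary error.
  let N := depolarizing (Fin s → α)
  obtain ⟨c, hc⟩ := kraus_eq_smul_one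
    (fun x : Fin C.decoder.r × Fin N.r =>
      C.decoder.kraus x.1 * actOn e (N.kraus x.2) * C.encoder) (fun ρ => by
      rw [Fintype.sum_prod_type]
      refine Eq.trans ?_ (hC s hs e N ρ)
      simp only [Channel.apply, Channel.applyOn, Matrix.mul_sum, Matrix.sum_mul,
        Matrix.conjTranspose_mul, Matrix.mul_assoc])
    (j, Fintype.equivFin _ (p, q))
  have h0 : ((√(Fintype.card (Fin s → α) : ℝ) : ℝ) : ℂ) ≠ 0 := by
    rw [Complex.ofReal_ne_zero, Real.sqrt_ne_zero']
    exact_mod_cast Fintype.card_pos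
  refine ⟨((√(Fintype.card (Fin s → α) : ℝ) : ℝ) : ℂ) * c, ?_⟩
  have h1 : N.kraus (Fintype.equivFin _ (p, q)) = _ := depolarizing_kraus p q
  rw [mul_smul, ← hc, h1]
  simp only [actOn_smul, Matrix.mul_smul, Matrix.smul_mul, smul_smul, mul_inv_cancel₀ h0, one_smul]

/-- The Knill-Laflamme condition for products of two correctable matrix units. -/
theorem QECC.Corrects.knillLaflamme {C : QECC α n k} {t s s' : ℕ} (hC : C.Corrects t) (hs : s ≤ t)
    (hs' : s' ≤ t) (e : Fin s ↪ Fin n) (f : Fin s' ↪ Fin n) (p q : Fin s → α) (p' q' : Fin s' → α) :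
    ∃ c : ℂ, C.encoderᴴ * (actOn e (Matrix.single p q 1) * actOn f (Matrix.single p' q' 1)) *
      C.encoder = c • (1 : Matrix (Fin k → α) (Fin k → α) ℂ) := by
  choose c hc using fun j => hC.decoder_mul hs e q p j
  choose c' hc' using fun j => hC.decoder_mul hs' f p' q' j
  refine ⟨∑ j, star (c j) * c' j, ?_⟩
  have h1 : (actOn e (Matrix.single q p (1 : ℂ)))ᴴ = actOn e (Matrix.single p q 1) := by
    rw [← actOn_conjTranspose, Matrix.conjTranspose_single, star_one]
  have h2 : ∀ j, (C.decoder.kraus j * actOn e (Matrix.single q p 1) * C.encoder)ᴴ *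
      (C.decoder.kraus j * actOn f (Matrix.single p' q' 1) * C.encoder) =
      (star (c j) * c' j) • (1 : Matrix (Fin k → α) (Fin k → α) ℂ) := by
    intro j
    rw [hc, hc', Matrix.conjTranspose_smul, Matrix.smul_mul, Matrix.mul_smul, smul_smul]
    simp
  rw [Finset.sum_smul, ← Finset.sum_congr rfl fun j _ => h2 j]
  -- With D_j the Kraus operators of the decoder, inserting ∑ D_j† D_j = 1 between the two errors
  -- writes the product as a sum of (D_j E† V)† (D_j F V), whose factors are scalars. Taking E†
  -- explains the swapped indices in `hc`.
  have h3 := congrArg (fun M => C.encoderᴴ * actOn e (Matrix.single p q 1) * M *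
    (actOn f (Matrix.single p' q' 1) * C.encoder)) C.decoder.trace_preserving
  simp only [Matrix.mul_one, Matrix.mul_sum, Matrix.sum_mul] at h3
  simp only [Matrix.conjTranspose_mul, h1]
  simp only [Matrix.mul_assoc] at h3 ⊢
  exact h3.symm

/-- Systems that are the union of two sets of correctable systems are uncorrelated with the
encoded state. -/
theorem QECC.Corrects.uncorrelated {C : QECC α n k} {t s s' : ℕ} (hC : C.Corrects t) (hs : s ≤ t)
    (hs' : s' ≤ t) (e : Fin s ↪ Fin n) (f : Fin s' ↪ Fin n) (hef : ∀ i j, e i ≠ f j)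
    {A B D : Type*} [Fintype A] [Fintype B] [Fintype D] [Nonempty B] [Nonempty D]
    (g : A → B → D → Fin n → α)
    (hsum : ∀ F : (Fin n → α) → ℂ, ∑ x, F x = ∑ a, ∑ b, ∑ c, F (g a b c))
    (hon : ∀ a b c a' b' c', ((∀ j, g a b c (e j) = g a' b' c' (e j)) ∧
      ∀ j, g a b c (f j) = g a' b' c' (f j)) ↔ a = a')
    (hoff : ∀ a b c a' b' c', (∀ i, (∀ j, e j ≠ i) → (∀ j, f j ≠ i) → g a b c i = g a' b' c' i) ↔
      b = b' ∧ c = c') (a a' : A) :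
    ∃ z : ℂ, ∀ r r', ∑ b, ∑ c, C.encoder (g a b c) r * star (C.encoder (g a' b c) r') =
      if r = r' then z else 0 := by
  classical
  obtain ⟨b₀⟩ := ‹Nonempty B›
  obtain ⟨c₀⟩ := ‹Nonempty D›
  -- The two matrix units multiply to |a'⟩⟨a| ⊗ 1, whose compression by the encoder is an entry of
  -- the reduced matrix. The choice of `b₀`, `c₀` is immaterial: the values on these systems depend
  -- on `a` only.
  obtain ⟨z, hz⟩ := hC.knillLaflamme hs hs' e f (fun j => g a' b₀ c₀ (e j))
    (fun j => g a b₀ c₀ (e j)) (fun j => g a' b₀ c₀ (f j)) (fun j => g a b₀ c₀ (f j))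
  refine ⟨z, fun r r' => ?_⟩
  have h1 := congrFun (congrFun hz r') r
  have h2 : (z • (1 : Matrix (Fin k → α) (Fin k → α) ℂ)) r' r = if r = r' then z else 0 := by
    rw [Matrix.smul_apply, Matrix.one_apply]
    simp [eq_comm]
  rw [← h2, ← h1]
  have h3 : ∀ a₁ b₁ c₁ a₂ b₂ c₂, (actOn e (Matrix.single (fun j => g a' b₀ c₀ (e j))
      (fun j => g a b₀ c₀ (e j)) 1) * actOn f (Matrix.single (fun j => g a' b₀ c₀ (f j))
      (fun j => g a b₀ c₀ (f j)) 1)) (g a₁ b₁ c₁) (g a₂ b₂ c₂) =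
      if a' = a₁ then if b₂ = b₁ then if c₂ = c₁ then if a₂ = a then (1 : ℂ) else 0 else 0 else 0
        else 0 := by
    intro a₁ b₁ c₁ a₂ b₂ c₂
    rw [actOn_mul_actOn_apply e f hef]
    simp only [hoff, Matrix.single_apply, funext_iff, ← hon a' b₀ c₀ a₁ b₁ c₁,
      eq_comm (a := a₂), ← hon a b₀ c₀ a₂ b₂ c₂, eq_comm (a := b₂), eq_comm (a := c₂)]
    split_ifs <;> first | tauto | simp
  have h4 : ∀ (V : Matrix (Fin n → α) (Fin k → α) ℂ) (M : Matrix (Fin n → α) (Fin n → α) ℂ),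
      (Vᴴ * M * V) r' r = ∑ x, ∑ y, star (V y r') * M y x * V x r := by
    intro V M
    simp only [Matrix.mul_apply, Finset.sum_mul, Matrix.conjTranspose_apply]
  rw [h4, hsum (fun x => ∑ y, _)]
  simp only [hsum (fun y => star (C.encoder y r') * _ * _), h3]
  simp [Finset.sum_ite_eq, Finset.sum_ite_eq', ite_mul, mul_comm]

end Singleton

/-! ### Three-colour partitions of the systems, and the bound. -/

section SingletonBound

variable {α : Type} {n : ℕ}

/-- A configuration of `n` systems put together from its restrictions to the systems of
colours `0`, `1` and `2`. -/
def glue (col : Fin n → Fin 3) (w : ∀ c, {i // col i = c} → α) (i : Fin n) : α :=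
  w (col i) ⟨i, rfl⟩

theorem glue_apply (col : Fin n → Fin 3) (w : ∀ c, {i // col i = c} → α) {i : Fin n} {c : Fin 3}
    (h : col i = c) : glue col w i = w c ⟨i, h⟩ := by
  subst h
  rfl

/-- The family of restrictions `a`, `b`, `c`. -/
def colourFamily (col : Fin n → Fin 3) (a : {i // col i = 0} → α)
    (b : {i // col i = 1} → α) (c : {i // col i = 2} → α) : ∀ k, {i // col i = k} → α
  | 0 => a
  | 1 => b
  | 2 => c

/-- Configurations of the systems of the three colours make up a configuration of all systems. -/
def glueEquiv (col : Fin n → Fin 3) :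
    ({i // col i = 0} → α) × ({i // col i = 1} → α) × ({i // col i = 2} → α) ≃ (Fin n → α) where
  toFun w := glue col (colourFamily col w.1 w.2.1 w.2.2)
  invFun x := (fun i => x i, fun i => x i, fun i => x i)
  left_inv w := by
    refine Prod.ext (funext fun i => ?_) (Prod.ext (funext fun i => ?_) (funext fun i => ?_))
    · exact glue_apply col (colourFamily col w.1 w.2.1 w.2.2) i.2
    · exact glue_apply col (colourFamily col w.1 w.2.1 w.2.2) i.2
    · exact glue_apply col (colourFamily col w.1 w.2.1 w.2.2) i.2
  right_inv x := by
    funext i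
    match h : col i with
    | 0 => exact glue_apply col _ h
    | 1 => exact glue_apply col _ h
    | 2 => exact glue_apply col _ h

theorem glueEquiv_apply_zero (col : Fin n → Fin 3) (a : {i // col i = 0} → α)
    (b : {i // col i = 1} → α) (c : {i // col i = 2} → α) {i : Fin n} (h : col i = 0) :
    glueEquiv col (a, b, c) i = a ⟨i, h⟩ :=
  glue_apply col (colourFamily col a b c) h

theorem glueEquiv_apply_one (col : Fin n → Fin 3) (a : {i // col i = 0} → α)
    (b : {i // col i = 1} → α) (c : {i // col i = 2} → α) {i : Fin n} (h : col i = 1) :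
    glueEquiv col (a, b, c) i = b ⟨i, h⟩ :=
  glue_apply col (colourFamily col a b c) h

theorem glueEquiv_apply_two (col : Fin n → Fin 3) (a : {i // col i = 0} → α)
    (b : {i // col i = 1} → α) (c : {i // col i = 2} → α) {i : Fin n} (h : col i = 2) :
    glueEquiv col (a, b, c) i = c ⟨i, h⟩ :=
  glue_apply col (colourFamily col a b c) h

theorem sum_glueEquiv [Fintype α] (col : Fin n → Fin 3) (F : (Fin n → α) → ℂ) :
    ∑ x, F x = ∑ a, ∑ b, ∑ c, F (glueEquiv col (a, b, c)) := by
  rw [← Equiv.sum_comp (glueEquiv col), Fintype.sum_prod_type]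
  simp_rw [Fintype.sum_prod_type]

variable [Fintype α] [DecidableEq α] [Nonempty α] {k : ℕ}

/-- If the systems of colour `0` and those of colour `1` are both unions of two sets of
correctable systems, then the encoded state fits into the systems of colour `2`. -/
theorem QECC.Corrects.card_le {C : QECC α n k} {t : ℕ} (hC : C.Corrects t)
    (col : Fin n → Fin 3) {s s' u u' : ℕ} (hs : s ≤ t) (hs' : s' ≤ t) (hu : u ≤ t) (hu' : u' ≤ t)
    (e : Fin s ↪ Fin n) (e' : Fin s' ↪ Fin n) (f : Fin u ↪ Fin n) (f' : Fin u' ↪ Fin n)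
    (hee : ∀ i j, e i ≠ e' j) (hff : ∀ i j, f i ≠ f' j)
    (he : ∀ i, col i = 0 ↔ (∃ j, e j = i) ∨ ∃ j, e' j = i)
    (hf : ∀ i, col i = 1 ↔ (∃ j, f j = i) ∨ ∃ j, f' j = i) :
    Fintype.card (Fin k → α) ≤ Fintype.card ({i // col i = 2} → α) := by
  refine card_le_card_of_uncorrelated
    (fun (a : {i // col i = 0} → α) (b : {i // col i = 1} → α) c r =>
      C.encoder (glueEquiv col (a, b, c)) r) ?_ ?_ ?_
  · by_contra! h
    obtain ⟨r⟩ : Nonempty (Fin k → α) := inferInstance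
    have h1 := congrFun (congrFun C.isometry r) r
    have h0 : ∀ x r, C.encoder x r = 0 := by
      intro x r
      rw [← (glueEquiv col).apply_symm_apply x]
      exact h _ _ _ r
    simp [Matrix.mul_apply, h0] at h1
  · refine hC.uncorrelated hs hs' e e' hee (fun a b c => glueEquiv col (a, b, c))
      (sum_glueEquiv col) ?_ ?_
    · intro a b c a' b' c'
      constructor
      · rintro ⟨h1, h2⟩
        funext ⟨i, hi⟩
        rcases (he i).1 hi with ⟨j, rfl⟩ | ⟨j, rfl⟩
        · simpa only [glueEquiv_apply_zero col _ _ _ hi] using h1 j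
        · simpa only [glueEquiv_apply_zero col _ _ _ hi] using h2 j
      · rintro rfl
        refine ⟨fun j => ?_, fun j => ?_⟩
        · have hi := (he (e j)).2 (Or.inl ⟨j, rfl⟩)
          simp only [glueEquiv_apply_zero col _ _ _ hi]
        · have hi := (he (e' j)).2 (Or.inr ⟨j, rfl⟩)
          simp only [glueEquiv_apply_zero col _ _ _ hi]
    · intro a b c a' b' c'
      have h3 : ∀ i, ((∀ j, e j ≠ i) → (∀ j, e' j ≠ i) →
          glueEquiv col (a, b, c) i = glueEquiv col (a', b', c') i) ↔
          (col i ≠ 0 → glueEquiv col (a, b, c) i = glueEquiv col (a', b', c') i) := by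
        intro i
        rw [Ne, he, not_or, not_exists, not_exists, and_imp]
      simp only [h3]
      constructor
      · intro h
        refine ⟨funext fun ⟨i, hi⟩ => ?_, funext fun ⟨i, hi⟩ => ?_⟩
        · simpa only [glueEquiv_apply_one col _ _ _ hi] using h i (by simp [hi])
        · simpa only [glueEquiv_apply_two col _ _ _ hi] using h i (by simp [hi])
      · rintro ⟨rfl, rfl⟩ i hi
        match h : col i with
        | 0 => exact absurd h hi
        | 1 => simp only [glueEquiv_apply_one col _ _ _ h]
        | 2 => simp only [glueEquiv_apply_two col _ _ _ h]
  · refine hC.uncorrelated hu hu' f f' hff (fun b a c => glueEquiv col (a, b, c))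
      (fun F => by rw [sum_glueEquiv col, Finset.sum_comm]) ?_ ?_
    · intro b a c b' a' c'
      constructor
      · rintro ⟨h1, h2⟩
        funext ⟨i, hi⟩
        rcases (hf i).1 hi with ⟨j, rfl⟩ | ⟨j, rfl⟩
        · simpa only [glueEquiv_apply_one col _ _ _ hi] using h1 j
        · simpa only [glueEquiv_apply_one col _ _ _ hi] using h2 j
      · rintro rfl
        refine ⟨fun j => ?_, fun j => ?_⟩
        · have hi := (hf (f j)).2 (Or.inl ⟨j, rfl⟩)
          simp only [glueEquiv_apply_one col _ _ _ hi]
        · have hi := (hf (f' j)).2 (Or.inr ⟨j, rfl⟩)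
          simp only [glueEquiv_apply_one col _ _ _ hi]
    · intro b a c b' a' c'
      have h3 : ∀ i, ((∀ j, f j ≠ i) → (∀ j, f' j ≠ i) →
          glueEquiv col (a, b, c) i = glueEquiv col (a', b', c') i) ↔
          (col i ≠ 1 → glueEquiv col (a, b, c) i = glueEquiv col (a', b', c') i) := by
        intro i
        rw [Ne, hf, not_or, not_exists, not_exists, and_imp]
      simp only [h3]
      constructor
      · intro h
        refine ⟨funext fun ⟨i, hi⟩ => ?_, funext fun ⟨i, hi⟩ => ?_⟩
        · simpa only [glueEquiv_apply_zero col _ _ _ hi] using h i (by simp [hi])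
        · simpa only [glueEquiv_apply_two col _ _ _ hi] using h i (by simp [hi])
      · rintro ⟨rfl, rfl⟩ i hi
        match h : col i with
        | 0 => simp only [glueEquiv_apply_zero col _ _ _ h]
        | 1 => exact absurd h hi
        | 2 => simp only [glueEquiv_apply_two col _ _ _ h]

/-- The interval is cut off at `n`, so a block may have fewer than `t` systems; this is why 4t ≤ n
need not be known beforehand. -/
theorem exists_embedding_range_interval (n l t : ℕ) : ∃ s ≤ t, ∃ e : Fin s ↪ Fin n,
    ∀ i : Fin n, (∃ j, e j = i) ↔ l ≤ i.val ∧ i.val < l + t := by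
  let S : Finset (Fin n) := {i | l ≤ i.val ∧ i.val < l + t}
  refine ⟨S.card, ?_, (S.orderEmbOfFin rfl).toEmbedding, fun i => ?_⟩
  · rw [← Finset.card_map Fin.valEmbedding]
    refine (Finset.card_le_card (t := Finset.Ico l (l + t)) fun x hx => ?_).trans (by simp)
    obtain ⟨i, hi, rfl⟩ := Finset.mem_map.1 hx
    simpa [S] using hi
  · exact (Set.ext_iff.1 (S.range_orderEmbOfFin rfl) i).trans (by simp [S])

/-- The quantum Singleton bound. -/
theorem QECC.Corrects.singleton_bound {d t : ℕ} (hd : 2 ≤ d) (hk : 1 ≤ k) {C : QECC (Fin d) n k}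
    (hC : C.Corrects t) : 4 * t + k ≤ n := by
  have : Nonempty (Fin d) := ⟨⟨0, by omega⟩⟩
  obtain ⟨s₀, hs₀, e₀, he₀⟩ := exists_embedding_range_interval n 0 t
  obtain ⟨s₁, hs₁, e₁, he₁⟩ := exists_embedding_range_interval n t t
  obtain ⟨s₂, hs₂, e₂, he₂⟩ := exists_embedding_range_interval n (2 * t) t
  obtain ⟨s₃, hs₃, e₃, he₃⟩ := exists_embedding_range_interval n (3 * t) t
  let col : Fin n → Fin 3 := fun i => if i.val < 2 * t then 0 else if i.val < 4 * t then 1 else 2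
  have h := hC.card_le col hs₀ hs₁ hs₂ hs₃ e₀ e₁ e₂ e₃
    (fun i j hij => by
      have h1 := (he₀ _).1 ⟨i, rfl⟩
      have h2 := (he₁ _).1 ⟨j, rfl⟩
      rw [hij] at h1
      omega)
    (fun i j hij => by
      have h1 := (he₂ _).1 ⟨i, rfl⟩
      have h2 := (he₃ _).1 ⟨j, rfl⟩
      rw [hij] at h1
      omega)
    (fun i => by
      rw [he₀, he₁]
      simp only [col]
      split_ifs <;> simp <;> omega)
    (fun i => by
      rw [he₂, he₃]
      simp only [col]
      split_ifs <;> simp <;> omega)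
  rw [Fintype.card_fun, Fintype.card_fun, Fintype.card_fin, Fintype.card_fin] at h
  have h1 := (Nat.pow_le_pow_iff_right (by omega)).1 h
  -- The subtraction is truncated: for n < 4t colour `2` is empty and the estimate becomes k ≤ 0,
  -- against `hk`.
  have h2 : Fintype.card {i : Fin n // col i = 2} ≤ n - 4 * t := by
    rw [Fintype.card_subtype, ← Finset.card_map Fin.valEmbedding]
    refine (Finset.card_le_card (t := Finset.Ico (4 * t) n) fun x hx => ?_).trans (by simp)
    obtain ⟨i, hi, rfl⟩ := Finset.mem_map.1 hx
    have hi : col i = 2 := by simpa using hi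
    simp only [col] at hi
    split_ifs at hi with h3 h4
    · simp at hi
    · simp at hi
    · simp
      omega
  omega

end SingletonBound

/-! ### Characters and eigenprojections -/

section Characters

/-- The character `a ↦ ω ^ a` of `ℤ/d`. -/
noncomputable def chi {d : ℕ} (a : ZMod d) : ℂ := omega d ^ a.val

theorem chi_zero {d : ℕ} : chi (0 : ZMod d) = 1 := by simp [chi]

variable {d : ℕ} [NeZero d]

theorem omega_isPrimitiveRoot (d : ℕ) [NeZero d] : IsPrimitiveRoot (omega d) d :=
  Complex.isPrimitiveRoot_exp d (NeZero.ne d)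

theorem chi_add (a b : ZMod d) : chi (a + b) = chi a * chi b := by
  rw [chi, chi, chi, ← pow_add, ZMod.val_add, ← pow_eq_pow_mod _ (omega_isPrimitiveRoot d).pow_eq_one]

theorem chi_injective : Function.Injective (chi (d := d)) := fun a b h =>
  ZMod.val_injective d ((omega_isPrimitiveRoot d).pow_inj (ZMod.val_lt a) (ZMod.val_lt b) h)

theorem chi_mul_chi_neg (a : ZMod d) : chi a * chi (-a) = 1 := by
  rw [← chi_add, add_neg_cancel, chi_zero]

theorem chi_neg (a : ZMod d) : chi (-a) = (chi a)⁻¹ :=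
  (inv_eq_of_mul_eq_one_right (chi_mul_chi_neg a)).symm

theorem star_chi (a : ZMod d) : star (chi a) = chi (-a) := by
  rw [chi_neg, chi, star_pow, ← inv_pow]
  congr 1
  have h := (omega_isPrimitiveRoot d).norm'_eq_one (NeZero.ne d)
  exact (Complex.inv_eq_conj h).symm

theorem sum_chi_pow (a : ZMod d) :
    ∑ j ∈ Finset.range d, chi a ^ j = if a = 0 then (d : ℂ) else 0 := by
  split_ifs with h
  · simp [h, chi_zero]
  · have h1 : chi a ≠ 1 := fun h1 => h (chi_injective (h1.trans chi_zero.symm))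
    rw [geom_sum_eq h1, chi, ← pow_mul, mul_comm, pow_mul, (omega_isPrimitiveRoot d).pow_eq_one]
    simp

theorem chi_natCast_mul (j : ℕ) (a : ZMod d) : chi ((j : ZMod d) * a) = chi a ^ j := by
  induction j with
  | zero => simp [chi_zero]
  | succ j ih => rw [Nat.cast_succ, add_mul, one_mul, chi_add, ih, pow_succ]

theorem sum_chi_mul (a : ZMod d) : ∑ b : ZMod d, chi (b * a) = if a = 0 then (d : ℂ) else 0 := by
  rw [← sum_chi_pow]
  refine Finset.sum_bij' (fun b _ => b.val) (fun j _ => (j : ZMod d)) ?_ ?_ ?_ ?_ ?_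
  · intro b _
    exact Finset.mem_range.2 (ZMod.val_lt b)
  · simp
  · simp
  · intro j hj
    exact ZMod.val_cast_of_lt (Finset.mem_range.1 hj)
  · intro b _
    rw [← chi_natCast_mul, ZMod.natCast_val, ZMod.cast_id]

variable {n : ℕ}

theorem mul_pow_eq_diagonal_mul {ι : Type*} [Fintype ι] [DecidableEq ι] {U M : Matrix ι ι ℂ}
    {w : ι → ℂ} (h : U * M = Matrix.diagonal w * U) (j : ℕ) :
    U * M ^ j = Matrix.diagonal (fun y => w y ^ j) * U := by
  induction j with
  | zero => simp
  | succ j ih =>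
    rw [pow_succ, ← Matrix.mul_assoc, ih, Matrix.mul_assoc, h, ← Matrix.mul_assoc,
      Matrix.diagonal_mul_diagonal]
    simp only [pow_succ]

/-- A unitary that diagonalises `M` diagonalises its eigenprojections. -/
theorem mul_eigenProj {U M : Matrix (Fin n → ZMod d) (Fin n → ZMod d) ℂ}
    {f : (Fin n → ZMod d) → ZMod d} (h : U * M = Matrix.diagonal (fun y => chi (f y)) * U)
    (b : ZMod d) :
    U * eigenProj M b = Matrix.diagonal (fun y => if f y = b then 1 else 0) * U := by
  have hd : (d : ℂ) ≠ 0 := NeZero.ne _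
  rw [eigenProj, Matrix.mul_smul, Matrix.mul_sum]
  simp_rw [Matrix.mul_smul, mul_pow_eq_diagonal_mul h]
  ext y x
  simp only [Matrix.smul_apply, Matrix.sum_apply, Matrix.diagonal_mul, smul_eq_mul]
  have h1 : ∀ j, (omega d)⁻¹ ^ (b.val * j) * (chi (f y) ^ j * U y x) = chi (f y - b) ^ j * U y x := by
    intro j
    rw [sub_eq_add_neg, chi_add, chi_neg, mul_pow, chi, chi, pow_mul, inv_pow]
    ring
  simp_rw [h1]
  rw [← Finset.sum_mul, sum_chi_pow]
  simp only [sub_eq_zero]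
  split_ifs <;> simp [hd]

theorem eigenProj_eq {U M : Matrix (Fin n → ZMod d) (Fin n → ZMod d) ℂ} (hU : Uᴴ * U = 1)
    {f : (Fin n → ZMod d) → ZMod d} (h : U * M = Matrix.diagonal (fun y => chi (f y)) * U)
    (b : ZMod d) :
    eigenProj M b = Uᴴ * Matrix.diagonal (fun y => if f y = b then 1 else 0) * U := by
  rw [Matrix.mul_assoc, ← mul_eigenProj h, ← Matrix.mul_assoc, hU, Matrix.one_mul]

/-- Completeness of the measurement, needed for trace preservation: in the eigenbasis given by `U`
the projections are the indicators of the fibres of `f`, which add up to 1. -/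
theorem sum_eigenProj_mul {U M : Matrix (Fin n → ZMod d) (Fin n → ZMod d) ℂ} (hU : Uᴴ * U = 1)
    {f : (Fin n → ZMod d) → ZMod d} (h : U * M = Matrix.diagonal (fun y => chi (f y)) * U) :
    ∑ b, (eigenProj M b)ᴴ * eigenProj M b = 1 := by
  have h1 : ∀ b, (eigenProj M b)ᴴ * eigenProj M b =
      Uᴴ * Matrix.diagonal (fun y => if f y = b then 1 else 0) * U := by
    intro b
    have h2 : (Matrix.diagonal fun y => if f y = b then (1 : ℂ) else 0)ᴴ *
        (Matrix.diagonal fun y => if f y = b then (1 : ℂ) else 0) =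
        Matrix.diagonal fun y => if f y = b then (1 : ℂ) else 0 := by
      rw [Matrix.diagonal_conjTranspose, Matrix.diagonal_mul_diagonal]
      congr 1
      funext y
      simp only [Pi.star_apply]
      split_ifs <;> simp
    have h3 : U * Uᴴ = 1 := mul_eq_one_comm.1 hU
    rw [eigenProj_eq hU h b, Matrix.conjTranspose_mul, Matrix.conjTranspose_mul,
      Matrix.conjTranspose_conjTranspose]
    conv_rhs => rw [← h2]
    simp only [Matrix.mul_assoc]
    rw [← Matrix.mul_assoc U, h3, Matrix.one_mul]
  simp_rw [h1]
  rw [← Finset.sum_mul, ← Finset.mul_sum]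
  have h2 : ∑ b, Matrix.diagonal (fun y => if f y = b then (1 : ℂ) else 0) = 1 := by
    ext x y
    simp only [Matrix.sum_apply, Matrix.diagonal_apply, Matrix.one_apply]
    split_ifs <;> simp
  rw [h2, Matrix.mul_one, hU]

theorem eigenProj_transpose (M : Matrix (Fin n → ZMod d) (Fin n → ZMod d) ℂ) (b : ZMod d) :
    (eigenProj M b)ᵀ = eigenProj Mᵀ b := by
  simp [eigenProj, Matrix.transpose_sum, Matrix.transpose_smul, Matrix.transpose_pow]

theorem actOn_eigenProj {m : ℕ} (e : Fin m ↪ Fin n)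
    (M : Matrix (Fin m → ZMod d) (Fin m → ZMod d) ℂ) (b : ZMod d) :
    eigenProj (actOn e M) b = actOn e (eigenProj M b) := by
  simp [eigenProj, actOn_smul, actOn_sum, actOn_pow]

end Characters

/-! ### The three-qutrit code -/

section ThreeQutrit

theorem sum_fin_three_arrow {β M : Type*} [Fintype β] [AddCommMonoid M]
    (F : (Fin 3 → β) → M) : ∑ x, F x = ∑ a, ∑ b, ∑ c, F ![a, b, c] := by
  let e : β × β × β ≃ (Fin 3 → β) :=
    { toFun := fun p => ![p.1, p.2.1, p.2.2]
      invFun := fun x => (x 0, x 1, x 2)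
      left_inv := fun p => rfl
      right_inv := fun x => by
        funext i
        fin_cases i <;> rfl }
  rw [← Equiv.sum_comp e, Fintype.sum_prod_type]
  simp_rw [Fintype.sum_prod_type]
  rfl

theorem xxx_apply (x y : Fin 3 → ZMod 3) :
    tensor ![shiftX 3, shiftX 3, shiftX 3] x y = if x = y + 1 then 1 else 0 := by
  simp only [tensor, Matrix.of_apply, Fin.prod_univ_three, shiftX, funext_iff, Fin.forall_fin_succ]
  simp [ite_and]
  split_ifs <;> simp_all

theorem zzz_eq : tensor ![clockZ 3, clockZ 3, clockZ 3] =
    Matrix.diagonal fun x : Fin 3 → ZMod 3 => chi (∑ i, x i) := by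
  ext x y
  by_cases h : x = y
  · subst h
    simp [tensor, Fin.prod_univ_three, clockZ, Fin.sum_univ_three, chi_add]
    simp [chi]
  · rw [Matrix.diagonal_apply_ne _ h]
    obtain ⟨i, hi⟩ := Function.ne_iff.1 h
    rw [tensor, Matrix.of_apply]
    refine Finset.prod_eq_zero (Finset.mem_univ i) ?_
    have : ![clockZ 3, clockZ 3, clockZ 3] i = clockZ 3 := by fin_cases i <;> rfl
    rw [this, clockZ, Matrix.diagonal_apply_ne _ hi]

/-- The decoding operation for the syndrome `a`. -/
noncomputable def decode (a : Fin 2 → ZMod 3) : Matrix (Fin 3 → ZMod 3) (Fin 3 → ZMod 3) ℂ :=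
  Matrix.of fun y x => if x 1 - x 0 = y 0 ∧ ∑ i, x i = y 2 + a 1 then
    ((√3 : ℝ) : ℂ)⁻¹ * chi ((y 1 + a 0) * x 0) else 0

/-- The orbits of x ↦ x + 1 are labelled by x 1 - x 0 and ∑ x_i, the latter invariant because 3 = 0.
`decode` is a Fourier transform along each orbit with dual variable y 1 + a 0, so a shift only
multiplies by a character. -/
theorem decode_add_one (a : Fin 2 → ZMod 3) (x y : Fin 3 → ZMod 3) :
    decode a y (x + 1) = chi (y 1 + a 0) * decode a y x := by
  have h3 : (3 : ZMod 3) = 0 := rfl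
  have h1 : ∑ i, (x i + 1) = ∑ i, x i := by
    simp [Finset.sum_add_distrib, h3]
  simp only [decode, Matrix.of_apply, h1, Pi.add_apply, Pi.one_apply, add_sub_add_right_eq_sub,
    mul_add, mul_one, chi_add]
  split_ifs <;> ring

theorem decode_eq_zero {a : Fin 2 → ZMod 3} {x y : Fin 3 → ZMod 3} (h : ∑ i, x i ≠ y 2 + a 1) :
    decode a y x = 0 := if_neg fun h' => h h'.2

theorem decode_conjTranspose_mul (a : Fin 2 → ZMod 3) : (decode a)ᴴ * decode a = 1 := by
  ext x x'
  have hr : star (((√3 : ℝ) : ℂ)⁻¹) * ((√3 : ℝ) : ℂ)⁻¹ = 3⁻¹ := by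
    rw [star_inv₀, Complex.star_def, Complex.conj_ofReal, ← mul_inv, ← Complex.ofReal_mul,
      Real.mul_self_sqrt (by norm_num)]
    simp
  -- For given `x` a single `u` and a single `w` survive; the remaining sum over `v` is a character
  -- sum that forces x' 0 = x 0.
  have h1 : ∀ u v w, star (decode a ![u, v, w] x) * decode a ![u, v, w] x' =
      if u = x 1 - x 0 then if w = ∑ i, x i - a 1 then
        if x' 1 - x' 0 = x 1 - x 0 ∧ ∑ i, x' i = ∑ i, x i then
        3⁻¹ * chi (a 0 * (x' 0 - x 0)) * chi (v * (x' 0 - x 0)) else 0 else 0 else 0 := by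
    intro u v w
    by_cases hu : u = x 1 - x 0
    · by_cases hw : w = ∑ i, x i - a 1
      · subst hu hw
        simp only [decode, Matrix.of_apply, Matrix.cons_val, sub_add_cancel, true_and, if_true]
        split_ifs
        · rw [star_mul', star_chi, mul_mul_mul_comm, hr, ← chi_add, mul_assoc, ← chi_add]
          congr 2
          ring
        · simp
      · rw [if_pos hu, if_neg hw, decode_eq_zero, star_zero, zero_mul]
        simpa [eq_sub_iff_add_eq, eq_comm] using hw
    · rw [if_neg hu]
      simp [decode, Ne.symm hu]
  rw [Matrix.mul_apply, sum_fin_three_arrow, Matrix.one_apply]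
  simp only [Matrix.conjTranspose_apply, h1]
  simp only [Finset.sum_ite_irrel, Finset.sum_const_zero, Finset.sum_ite_eq', Finset.mem_univ, if_true]
  rw [← Finset.mul_sum, sum_chi_mul]
  by_cases h : x = x'
  · subst h
    simp [chi_zero]
  · rw [if_neg h]
    split_ifs with h2 h3
    · refine absurd ?_ h
      have h0 : x' 0 = x 0 := sub_eq_zero.1 h3
      have h4 : x' 1 = x 1 := by simpa [h0] using h2.1
      have h5 : x' 2 = x 2 := by simpa [Fin.sum_univ_three, h0, h4] using h2.2
      funext i
      fin_cases i
      exacts [h0.symm, h4.symm, h5.symm]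
    · simp
    · rfl

end ThreeQutrit

/-! ### Syndrome spaces, detection of one error, and decoding. -/

section ThreeQutritCode

theorem star_dotProduct_actOn_mulVec {n m : ℕ} {α : Type} [Fintype α] [DecidableEq α]
    (e : Fin m ↪ Fin n) (E : Matrix (Fin m → α) (Fin m → α) ℂ) (φ ψ : (Fin n → α) → ℂ) :
    star φ ⬝ᵥ (actOn e E *ᵥ ψ) =
      ∑ x, star (φ x) * ∑ p, E (fun j => x (e j)) p * ψ (overwrite e p x) := by
  simp only [dotProduct, Matrix.mulVec, sum_actOn_mul, Pi.star_apply]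

theorem mem_syndromeSpace_iff (s : Fin 2 → ZMod 3) (ψ : (Fin 3 → ZMod 3) → ℂ) :
    ψ ∈ syndromeSpace threeQutritGenerators s ↔
      (∀ x, ψ x = chi (s 0) * ψ (x + 1)) ∧ ∀ x, ∑ i, x i ≠ s 1 → ψ x = 0 := by
  have h1 : ∀ x, (tensor ![shiftX 3, shiftX 3, shiftX 3] *ᵥ ψ) x = ψ (x - 1) := by
    intro x
    simp [Matrix.mulVec, dotProduct, xxx_apply, ← sub_eq_iff_eq_add]
  have h2 : ∀ x, (tensor ![clockZ 3, clockZ 3, clockZ 3] *ᵥ ψ) x = chi (∑ i, x i) * ψ x := by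
    intro x
    rw [zzz_eq, Matrix.mulVec_diagonal]
  simp only [syndromeSpace, Submodule.mem_iInf, Fin.forall_fin_two, LinearMap.mem_ker,
    LinearMap.sub_apply, Matrix.toLin'_apply, LinearMap.smul_apply, LinearMap.id_apply, sub_eq_zero,
    threeQutritGenerators, Matrix.cons_val_zero, Matrix.cons_val_one, funext_iff, Pi.smul_apply,
    smul_eq_mul, h1, h2]
  refine and_congr ⟨fun h x => ?_, fun h x => ?_⟩ (forall_congr' fun x => ?_)
  · have := h (x + 1)
    rwa [add_sub_cancel_right] at this
  · have := h (x - 1)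
    rwa [sub_add_cancel] at this
  · change chi _ * _ = chi _ * _ ↔ _
    rw [mul_eq_mul_right_iff, chi_injective.eq_iff]
    tauto

/-- Changing a single coordinate changes the sum; hence `ZZZ` sees every off-diagonal one-qutrit
error. -/
theorem AgreeOff.eq_of_sum_eq {n : ℕ} {e : Fin 1 ↪ Fin n} {x y : Fin n → ZMod 3}
    (h : AgreeOff e x y) (hs : ∑ i, x i = ∑ i, y i) : x = y := by
  refine h.eq fun j => ?_
  have h1 : ∑ i, (x i - y i) = x (e j) - y (e j) := by
    refine Finset.sum_eq_single (e j) (fun i _ hi => ?_) (by simp)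
    rw [h i fun j' hj' => hi (by rw [← hj', Subsingleton.elim j j']), sub_self]
  rw [Finset.sum_sub_distrib, hs, sub_self] at h1
  exact (sub_eq_zero.1 h1.symm)

/-- The three-qutrit code with any syndrome detects one error. -/
theorem exists_detection_constant {m : ℕ} (hm : m ≤ 1) (e : Fin m ↪ Fin 3)
    (E : Matrix (Fin m → ZMod 3) (Fin m → ZMod 3) ℂ) : ∃ c : ℂ, ∀ s : Fin 2 → ZMod 3,
    ∀ φ ∈ syndromeSpace threeQutritGenerators s, ∀ ψ ∈ syndromeSpace threeQutritGenerators s,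
      star φ ⬝ᵥ (actOn e E *ᵥ ψ) = c * (star φ ⬝ᵥ ψ) := by
  obtain rfl | rfl : m = 0 ∨ m = 1 := by omega
  · refine ⟨E default default, fun s φ _ ψ _ => ?_⟩
    have : E = E default default • (1 : Matrix _ _ ℂ) := by
      ext x y
      simp [Subsingleton.elim x default, Subsingleton.elim y default]
    conv_lhs => rw [this, actOn_smul, actOn_one, Matrix.smul_mulVec, Matrix.one_mulVec,
      dotProduct_smul, smul_eq_mul]
  refine ⟨3⁻¹ * ∑ q : ZMod 3, E (fun _ => q) (fun _ => q), fun s φ hφ ψ hψ => ?_⟩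
  rw [mem_syndromeSpace_iff] at hφ hψ
  set h : ZMod 3 → ℂ := fun q => E (fun _ => q) (fun _ => q) with hh
  set g : (Fin 3 → ZMod 3) → ℂ := fun x => star (φ x) * ψ x with hg
  have h1 : star φ ⬝ᵥ (actOn e E *ᵥ ψ) = ∑ x, g x * h (x (e 0)) := by
    rw [star_dotProduct_actOn_mulVec]
    refine Finset.sum_congr rfl fun x _ => ?_
    by_cases hx : ∑ i, x i = s 1
    · rw [Finset.sum_eq_single (fun _ => x (e 0))]
      · have h2 : overwrite e (fun _ => x (e 0)) x = x :=
          ((agreeOff_overwrite e _ x).eq fun j => by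
            rw [overwrite_apply, Subsingleton.elim j 0]).symm
        have h3 : (fun j => x (e j)) = fun _ => x (e 0) :=
          funext fun j => by rw [Subsingleton.elim j 0]
        rw [h2, h3]
        simp only [hg, hh]
        ring
      · intro p _ hp
        rw [hψ.2, mul_zero]
        intro hs
        refine hp (funext fun j => ?_)
        have h4 := (agreeOff_overwrite e p x).eq_of_sum_eq (hx.trans hs.symm)
        rw [← overwrite_apply e p x j, ← h4, Subsingleton.elim j 0]
      · simp
    · simp [hg, hφ.2 x hx]
  -- The phases of `φ` and `ψ` are conjugate to each other and cancel, as both vectors have the same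
  -- `XXX` eigenvalue.
  have h2 : ∀ x, g (x + 1) = g x := by
    intro x
    simp only [hg]
    rw [hφ.1 x, hψ.1 x, star_mul', star_chi, mul_mul_mul_comm, mul_comm (chi _), chi_mul_chi_neg,
      one_mul]
  have h3 : ∀ f : ZMod 3 → ℂ, ∑ x, g x * f (x (e 0)) = ∑ x, g x * f (x (e 0) + 1) := by
    intro f
    rw [← Equiv.sum_comp (Equiv.addRight (1 : Fin 3 → ZMod 3))]
    simp [h2]
  have h4 := h3 h
  have h5 := h3 fun q => h (q + 1)
  have h6 : ∀ q : ZMod 3, h q + h (q + 1) + h (q + 1 + 1) = ∑ q, h q := by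
    intro q
    rw [← Equiv.sum_comp (Equiv.addLeft q)]
    refine Eq.trans ?_ (Fin.sum_univ_three _).symm
    change _ = h (q + 0) + h (q + 1) + h (q + (1 + 1))
    rw [add_zero, add_assoc q]
  -- The values of `x (e 0)` under the three shifts exhaust ℤ/3, and by invariance of `g` each shift
  -- contributes the same sum.
  have h7 : (∑ x, g x) * ∑ q, h q = 3 * ∑ x, g x * h (x (e 0)) := by
    have h8 : ∀ x, g x * ∑ q, h q =
        g x * h (x (e 0)) + g x * h (x (e 0) + 1) + g x * h (x (e 0) + 1 + 1) := by
      intro x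
      rw [← h6 (x (e 0)), mul_add, mul_add]
    rw [Finset.sum_mul, Finset.sum_congr rfl fun x _ => h8 x, Finset.sum_add_distrib,
      Finset.sum_add_distrib, ← h5, ← h4]
    ring
  have h8 : star φ ⬝ᵥ ψ = ∑ x, g x := rfl
  rw [h1, h8, mul_assoc, mul_comm (∑ q, h q), h7]
  ring

theorem threeQutritCode_detects : Detects threeQutritCode 1 := fun _ hm e E =>
  (exists_detection_constant hm e E).imp fun _ hc => hc 0

theorem decode_mem_unitaryGroup (a : Fin 2 → ZMod 3) :
    decode a ∈ Matrix.unitaryGroup (Fin 3 → ZMod 3) ℂ := by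
  rw [Matrix.mem_unitaryGroup_iff', Matrix.star_eq_conjTranspose, decode_conjTranspose_mul]

/-- Bob's decoding operation for the syndrome `b`. -/
noncomputable def decodeConj (b : Fin 2 → ZMod 3) : Matrix (Fin 3 → ZMod 3) (Fin 3 → ZMod 3) ℂ :=
  (decode ![-b 0, b 1]).map star

theorem decodeConj_mem_unitaryGroup (b : Fin 2 → ZMod 3) :
    decodeConj b ∈ Matrix.unitaryGroup (Fin 3 → ZMod 3) ℂ := by
  have h := decode_conjTranspose_mul ![-b 0, b 1]
  rw [Matrix.mem_unitaryGroup_iff', Matrix.star_eq_conjTranspose]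
  have h1 := congrArg (fun M => M.map (starRingEnd ℂ)) h
  simp only [Matrix.map_mul] at h1
  rw [Matrix.map_one _ (map_zero _) (map_one _)] at h1
  exact h1

theorem mul_xxx_apply (D : Matrix (Fin 3 → ZMod 3) (Fin 3 → ZMod 3) ℂ) (y x : Fin 3 → ZMod 3) :
    (D * tensor ![shiftX 3, shiftX 3, shiftX 3]) y x = D y (x + 1) := by
  simp [Matrix.mul_apply, xxx_apply]

theorem decode_mul_xxx (a : Fin 2 → ZMod 3) :
    decode a * tensor ![shiftX 3, shiftX 3, shiftX 3] =
      Matrix.diagonal (fun y => chi (y 1 + a 0)) * decode a := by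
  ext y x
  rw [mul_xxx_apply, decode_add_one, Matrix.diagonal_mul]

/-- The transpose of the shift is its inverse, so the eigenvalues are inverted: the origin of the
sign in Bob's first outcome. -/
theorem decode_mul_xxx_transpose (a : Fin 2 → ZMod 3) :
    decode a * (tensor ![shiftX 3, shiftX 3, shiftX 3])ᵀ =
      Matrix.diagonal (fun y => chi (-(y 1 + a 0))) * decode a := by
  ext y x
  have h : (decode a * (tensor ![shiftX 3, shiftX 3, shiftX 3])ᵀ) y x = decode a y (x - 1) := by
    simp [Matrix.mul_apply, xxx_apply, ← sub_eq_iff_eq_add]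
  have h1 := decode_add_one a (x - 1) y
  rw [sub_add_cancel] at h1
  rw [h, Matrix.diagonal_mul, h1, ← mul_assoc, mul_comm (chi _), chi_mul_chi_neg, one_mul]

theorem decode_mul_zzz (a : Fin 2 → ZMod 3) :
    decode a * tensor ![clockZ 3, clockZ 3, clockZ 3] =
      Matrix.diagonal (fun y => chi (y 2 + a 1)) * decode a := by
  ext y x
  rw [zzz_eq, Matrix.mul_diagonal, Matrix.diagonal_mul]
  by_cases h : ∑ i, x i = y 2 + a 1
  · rw [h, mul_comm]
  · rw [decode_eq_zero h, mul_zero, zero_mul]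

/-- A family of unitaries that shift all eigenvectors of equal syndrome to fixed positions is
a family of decoding operations. -/
theorem isDecoding_of_apply (D : (Fin 2 → ZMod 3) → Matrix (Fin 3 → ZMod 3) (Fin 3 → ZMod 3) ℂ)
    (hD : ∀ s, D s ∈ Matrix.unitaryGroup (Fin 3 → ZMod 3) ℂ) (f : ZMod 3 → ZMod 3)
    (hf : ∀ u, f u = 0 → u = 0)
    (hX : ∀ s y x, D s y (x + 1) = chi (f (y 1) + s 0) * D s y x)
    (hZ : ∀ s y x, ∑ i, x i ≠ y 2 + s 1 → D s y x = 0) :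
    IsDecoding threeQutritGenerators 1 D := by
  refine fun s => ⟨hD s, fun ψ hψ j hj => ?_⟩
  rw [mem_syndromeSpace_iff] at hψ
  simp only [Matrix.mulVec, dotProduct]
  by_cases h2 : j 2 = 0
  · have h1 : j 1 ≠ 0 := by
      obtain ⟨i, hi, hi'⟩ := hj
      fin_cases i
      · simp at hi
      · exact hi'
      · exact absurd h2 hi'
    -- Under a shift of `x` the phases for `s 0` in `D` and `ψ` cancel, leaving a root of unity that
    -- is not 1 when `j 1 ≠ 0`; the amplitude must vanish.
    have h3 : ∑ x, D s j x * ψ x = chi (f (j 1)) * ∑ x, D s j x * ψ x := by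
      conv_lhs => rw [← Equiv.sum_comp (Equiv.addRight (1 : Fin 3 → ZMod 3))]
      rw [Finset.mul_sum]
      refine Finset.sum_congr rfl fun x _ => ?_
      rw [hψ.1 x, Equiv.coe_addRight, hX, chi_add]
      ring
    have h4 : chi (f (j 1)) ≠ 1 := fun h4 => h1 (hf _ (chi_injective (h4.trans chi_zero.symm)))
    by_contra h5
    exact h4 (mul_right_cancel₀ h5 (h3.symm.trans (one_mul _).symm))
  · refine Finset.sum_eq_zero fun x _ => ?_
    by_cases hx : ∑ i, x i = s 1
    · rw [hZ, zero_mul]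
      rw [hx]
      simpa using h2
    · rw [hψ.2 x hx, mul_zero]

theorem decode_isDecoding : IsDecoding threeQutritGenerators 1 decode :=
  isDecoding_of_apply decode decode_mem_unitaryGroup id (fun _ => id)
    (fun s y x => decode_add_one s x y) fun _ _ _ => decode_eq_zero

theorem decodeConj_isDecoding : IsDecoding threeQutritGenerators 1 decodeConj := by
  refine isDecoding_of_apply decodeConj decodeConj_mem_unitaryGroup (fun u => -u)
    (fun _ => neg_eq_zero.1) (fun s y x => ?_) (fun s y x h => ?_)
  · rw [decodeConj, Matrix.map_apply, Matrix.map_apply, decode_add_one, star_mul', star_chi]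
    simp [add_comm]
  · rw [decodeConj, Matrix.map_apply, decode_eq_zero (by simpa using h), star_zero]

/-- The columns of the adjoint of the decoding operation at the decoded positions belong to the
syndrome space. -/
theorem star_decode_mem (a : Fin 2 → ZMod 3) {y : Fin 3 → ZMod 3} (h1 : y 1 = 0) (h2 : y 2 = 0) :
    (fun x => star (decode a y x)) ∈ syndromeSpace threeQutritGenerators a := by
  rw [mem_syndromeSpace_iff]
  refine ⟨fun x => ?_, fun x hx => ?_⟩
  · rw [decode_add_one, h1, zero_add, star_mul', star_chi, ← mul_assoc, chi_mul_chi_neg, one_mul]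
  · rw [decode_eq_zero (by simpa [h2] using hx), star_zero]

theorem threeQutritCode_finrank : Module.finrank ℂ threeQutritCode = 3 ^ 1 := by
  have hU : decode 0 * (decode 0)ᴴ = 1 := mul_eq_one_comm.1 (decode_conjTranspose_mul 0)
  -- `F` places the data in the decoded positions and undoes `decode 0`; it is an encoder whose
  -- image is the coding space.
  let F : (ZMod 3 → ℂ) →ₗ[ℂ] ((Fin 3 → ZMod 3) → ℂ) :=
    ∑ u, (LinearMap.proj u).smulRight fun x => star (decode 0 ![u, 0, 0] x)
  have hF : ∀ v, F v = ∑ u, v u • fun x => star (decode 0 ![u, 0, 0] x) := by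
    intro v
    simp [F]
  have hF' : ∀ v, F v = (decode 0)ᴴ *ᵥ fun y => if y 1 = 0 ∧ y 2 = 0 then v (y 0) else 0 := by
    intro v
    rw [hF]
    ext x
    rw [Matrix.mulVec, dotProduct, sum_fin_three_arrow]
    have h1 : ∀ u p q, (decode 0)ᴴ x ![u, p, q] * (if ![u, p, q] 1 = 0 ∧ ![u, p, q] 2 = 0 then
        v (![u, p, q] 0) else 0) =
        if q = 0 then if p = 0 then v u * star (decode 0 ![u, p, q] x) else 0 else 0 := by
      intro u p q
      by_cases hp : p = 0 <;> by_cases hq : q = 0 <;> simp [hp, hq, mul_comm]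
    simp only [h1]
    simp
  have hinj : Function.Injective F := by
    intro v v' h
    rw [hF', hF'] at h
    have h1 := congrArg (fun ψ => decode 0 *ᵥ ψ) h
    simp only [Matrix.mulVec_mulVec, hU, Matrix.one_mulVec] at h1
    funext u
    simpa using congrFun h1 ![u, 0, 0]
  have hrange : LinearMap.range F = threeQutritCode := by
    apply le_antisymm
    · rintro _ ⟨v, rfl⟩
      rw [hF]
      exact Submodule.sum_mem _ fun u _ => Submodule.smul_mem _ _ (star_decode_mem 0 rfl rfl)
    · intro ψ hψ
      refine ⟨fun u => (decode 0 *ᵥ ψ) ![u, 0, 0], ?_⟩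
      have h1 : (fun y : Fin 3 → ZMod 3 => if y 1 = 0 ∧ y 2 = 0 then
          (decode 0 *ᵥ ψ) ![y 0, 0, 0] else 0) = decode 0 *ᵥ ψ := by
        funext y
        split_ifs with h
        · congr 1
          funext i
          fin_cases i
          exacts [rfl, h.1.symm, h.2.symm]
        · refine ((decode_isDecoding 0).2 ψ hψ y ?_).symm
          by_cases h1 : y 1 = 0
          · exact ⟨2, by simp, fun h2 => h ⟨h1, h2⟩⟩
          · exact ⟨1, by simp, h1⟩
      rw [hF', h1, Matrix.mulVec_mulVec, decode_conjTranspose_mul, Matrix.one_mulVec]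
  rw [← hrange, LinearMap.finrank_range_of_inj hinj]
  simp

end ThreeQutritCode

/-! ### Pure states of pairs -/

section PureStates

/-- The (unnormalised) pure state with amplitudes `Ψ`, where Alice's halves index the rows and
Bob's halves the columns of `Ψ`. -/
def pureState {α : Type} {n : ℕ} (Ψ : Matrix (Fin n → α) (Fin n → α) ℂ) :
    Matrix (Fin n → α × α) (Fin n → α × α) ℂ :=
  Matrix.of fun x y => Ψ (fun i => (x i).1) (fun i => (x i).2) *
    star (Ψ (fun i => (y i).1) fun i => (y i).2)

variable {α : Type} {n : ℕ}

theorem pureState_eq_vecMulVec (Ψ : Matrix (Fin n → α) (Fin n → α) ℂ) :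
    pureState Ψ = Matrix.vecMulVec (fun x => Ψ (fun i => (x i).1) fun i => (x i).2)
      (star fun x : Fin n → α × α => Ψ (fun i => (x i).1) fun i => (x i).2) := rfl

theorem sum_localOp {ι κ : Type*} (s : Finset ι) (t : Finset κ)
    (A : ι → Matrix (Fin n → α) (Fin n → α) ℂ) (B : κ → Matrix (Fin n → α) (Fin n → α) ℂ) :
    ∑ i ∈ s, ∑ j ∈ t, localOp (A i) (B j) = localOp (∑ i ∈ s, A i) (∑ j ∈ t, B j) := by
  ext x y
  simp only [localOp, Matrix.sum_apply, Matrix.of_apply, Finset.sum_mul_sum]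

theorem localOp_one [DecidableEq α] : localOp (α := α) (n := n) 1 1 = 1 := by
  ext x y
  simp only [localOp, Matrix.of_apply, Matrix.one_apply, funext_iff, Prod.ext_iff, forall_and]
  split_ifs <;> simp_all

variable [Fintype α]

theorem localOp_mulVec (A B Ψ : Matrix (Fin n → α) (Fin n → α) ℂ) (x : Fin n → α × α) :
    (localOp A B *ᵥ fun x => Ψ (fun i => (x i).1) fun i => (x i).2) x =
      (A * Ψ * Bᵀ) (fun i => (x i).1) fun i => (x i).2 := by
  rw [Matrix.mulVec, dotProduct, ← Equiv.sum_comp (Equiv.arrowProdEquivProdArrow _ _ _).symm,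
    Fintype.sum_prod_type, Matrix.mul_apply, Finset.sum_comm]
  refine Finset.sum_congr rfl fun q _ => ?_
  rw [Matrix.mul_apply, Finset.sum_mul]
  refine Finset.sum_congr rfl fun p _ => ?_
  simp only [localOp, Matrix.of_apply, Equiv.arrowProdEquivProdArrow, Matrix.transpose_apply,
    Equiv.coe_fn_symm_mk]
  ring

theorem localOp_conjTranspose_mul (A B A' B' : Matrix (Fin n → α) (Fin n → α) ℂ) :
    (localOp A B)ᴴ * localOp A' B' = localOp (Aᴴ * A') (Bᴴ * B') := by
  ext x y
  rw [Matrix.mul_apply, ← Equiv.sum_comp (Equiv.arrowProdEquivProdArrow _ _ _).symm,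
    Fintype.sum_prod_type]
  simp only [localOp, Matrix.of_apply, Matrix.mul_apply, Equiv.arrowProdEquivProdArrow,
    Matrix.conjTranspose_apply, Equiv.coe_fn_symm_mk, Finset.sum_mul_sum]
  refine Finset.sum_congr rfl fun q _ => Finset.sum_congr rfl fun p _ => ?_
  rw [star_mul']
  ring

theorem localOp_mul_pureState_mul (A B Ψ : Matrix (Fin n → α) (Fin n → α) ℂ) :
    localOp A B * pureState Ψ * (localOp A B)ᴴ = pureState (A * Ψ * Bᵀ) := by
  rw [pureState_eq_vecMulVec, pureState_eq_vecMulVec, Matrix.mul_vecMulVec, Matrix.vecMulVec_mul,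
    ← Matrix.star_mulVec]
  have h : (localOp A B *ᵥ fun x => Ψ (fun i => (x i).1) fun i => (x i).2) = _ :=
    funext (localOp_mulVec A B Ψ)
  rw [h]

variable [DecidableEq α]

/-- Error operators on some of the pairs act on Alice's halves only, up to moving Bob's part of the
error to Alice's side of the perfect pairs. -/
theorem exists_applyOn_eprPairs {m : ℕ} (N : Channel (Fin m → α × α) (Fin m → α × α))
    (e : Fin m ↪ Fin n) : ∃ κ : Fin N.r → Matrix (Fin m → α) (Fin m → α) ℂ,
      N.applyOn e (eprPairs α n) = ∑ i, pureState (actOn e (κ i)) := by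
  set c : ℂ := ((√((Fintype.card α : ℝ) ^ n) : ℝ) : ℂ)⁻¹ with hc
  have hcc : c * star c = ((Fintype.card α : ℂ) ^ n)⁻¹ := by
    rw [hc, star_inv₀, Complex.star_def, Complex.conj_ofReal, ← mul_inv, ← Complex.ofReal_mul,
      Real.mul_self_sqrt (by positivity)]
    simp
  have hepr : eprPairs α n = pureState (c • (1 : Matrix (Fin n → α) (Fin n → α) ℂ)) := by
    ext x y
    simp only [eprPairs, pureState, Matrix.of_apply, Matrix.smul_apply, Matrix.one_apply, funext_iff]
    rw [← hcc]
    split_ifs <;> simp_all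
  -- The Kraus operator applied to ∑ |r⟩|r⟩ on the affected pairs, reshaped to a matrix; `c` is the
  -- normalisation of all `n` pairs.
  refine ⟨fun i => c • Matrix.of fun p q => ∑ r : Fin m → α,
    N.kraus i (fun j => (p j, q j)) fun j => (r j, r j), Finset.sum_congr rfl fun i _ => ?_⟩
  rw [hepr, pureState_eq_vecMulVec, pureState_eq_vecMulVec, Matrix.mul_vecMulVec, Matrix.vecMulVec_mul,
    ← Matrix.star_mulVec]
  have h : (actOn e (N.kraus i) *ᵥ fun x =>
      (c • (1 : Matrix (Fin n → α) (Fin n → α) ℂ)) (fun i => (x i).1) fun i => (x i).2) =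
      fun x => actOn e (c • Matrix.of fun p q => ∑ r : Fin m → α,
        N.kraus i (fun j => (p j, q j)) fun j => (r j, r j)) (fun i => (x i).1) fun i => (x i).2 := by
    funext x
    rw [Matrix.mulVec, dotProduct, sum_actOn_mul, actOn_apply]
    have h1 : ∀ p : Fin m → α × α, (fun i => (overwrite e p x i).1) = (fun i => (overwrite e p x i).2)
        ↔ (∀ j, (p j).1 = (p j).2) ∧ AgreeOff e (fun i => (x i).1) fun i => (x i).2 := by
      intro p
      constructor
      · intro h
        refine ⟨fun j => ?_, fun i hi => ?_⟩
        · have := congrFun h (e j)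
          simpa only [overwrite_apply] using this
        · have := congrFun h i
          simpa only [overwrite_apply_of_ne e p x hi] using this
      · rintro ⟨h, h'⟩
        funext i
        by_cases hi : ∃ j, e j = i
        · obtain ⟨j, rfl⟩ := hi
          simpa only [overwrite_apply] using h j
        · push Not at hi
          simpa only [overwrite_apply_of_ne e p x hi] using h' i hi
    simp only [Matrix.smul_apply, Matrix.one_apply, h1]
    split_ifs with h2
    · simp only [h2, and_true, smul_eq_mul, mul_ite, mul_one, mul_zero, Matrix.of_apply]
      rw [← Finset.sum_filter, Finset.mul_sum]
      refine Finset.sum_bij' (fun p _ j => (p j).1) (fun r _ j => (r j, r j)) ?_ ?_ ?_ ?_ ?_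
      · simp
      · simp
      · intro p hp
        funext j
        exact Prod.ext rfl ((Finset.mem_filter.1 hp).2 j)
      · simp
      · intro p hp
        have : (fun j => ((p j).1, (p j).1)) = p :=
          funext fun j => Prod.ext rfl ((Finset.mem_filter.1 hp).2 j)
        simp only [this]
        exact mul_comm _ _
    · simp [h2]
  rw [h]

end PureStates

/-! ### Running protocols -/

section Run

variable {β : Type} [Fintype β] [DecidableEq β] {n k : ℕ}

theorem discardRest_sum {ι : Type*} (s : Finset ι) (keep : Fin k ↪ Fin n)
    (ρ : ι → Matrix (Fin n → β) (Fin n → β) ℂ) :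
    discardRest keep (∑ i ∈ s, ρ i) = ∑ i ∈ s, discardRest keep (ρ i) := by
  classical
  induction s using Finset.induction_on with
  | empty => ext u v; simp [discardRest]
  | insert i s hi ih =>
    rw [Finset.sum_insert hi, Finset.sum_insert hi, ← ih]
    ext u v
    simp only [discardRest, Matrix.of_apply, Matrix.add_apply, ← Finset.sum_add_distrib]
    refine Finset.sum_congr rfl fun x _ => Finset.sum_congr rfl fun y _ => ?_
    split_ifs <;> simp

theorem trace_discardRest (keep : Fin k ↪ Fin n) (ρ : Matrix (Fin n → β) (Fin n → β) ℂ) :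
    (discardRest keep ρ).trace = ρ.trace := by
  simp only [Matrix.trace, Matrix.diag_apply, discardRest, Matrix.of_apply]
  rw [Finset.sum_comm]
  refine Finset.sum_congr rfl fun x _ => ?_
  rw [Finset.sum_comm, Finset.sum_eq_single x]
  · rw [Finset.sum_eq_single fun i => x (keep i)]
    · simp
    · intro u _ hu
      rw [if_neg]
      rintro ⟨h, -⟩
      exact hu (funext fun i => (h i).symm)
    · simp
  · intro y _ hy
    refine Finset.sum_eq_zero fun u _ => if_neg ?_
    rintro ⟨h1, h2, h3⟩
    exact hy ((show AgreeOff keep x y from h3).eq fun j => (h1 j).trans (h2 j).symm).symm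
  · simp

theorem trace_eprPairs (α : Type) [Fintype α] [DecidableEq α] [Nonempty α] (n : ℕ) :
    (eprPairs α n).trace = 1 := by
  have h : (Fintype.card α : ℂ) ^ n ≠ 0 := by simp
  rw [Matrix.trace, ← Equiv.sum_comp (Equiv.arrowProdEquivProdArrow _ _ _).symm,
    Fintype.sum_prod_type]
  simp only [Matrix.diag_apply, eprPairs, Matrix.of_apply, Equiv.arrowProdEquivProdArrow,
    Equiv.coe_fn_symm_mk, and_self, ← funext_iff]
  simp [h]

variable {d : ℕ} [NeZero d]

/-- By linearity the Kraus operators of an error can be treated one at a time, as unnormalised pure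
states. -/
theorem Protocol.run_sum {ι : Type*} (P : Protocol d n k) (s : Finset ι)
    (ρ : ι → Matrix (Fin n → ZMod d × ZMod d) (Fin n → ZMod d × ZMod d) ℂ) :
    P.run (∑ i ∈ s, ρ i) = ∑ i ∈ s, P.run (ρ i) := by
  induction P generalizing ρ with
  | finish UA UB keep =>
    simp only [Protocol.run, Matrix.mul_sum, Matrix.sum_mul, discardRest_sum]
  | measure M next ih =>
    simp only [Protocol.run, Matrix.mul_sum, Matrix.sum_mul, ih]
    rw [Finset.sum_comm]
    simp_rw [Finset.sum_comm (s := s)]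
    rw [Finset.sum_comm]

theorem Protocol.trace_run_finish {UA UB : Matrix (Fin n → ZMod d) (Fin n → ZMod d) ℂ}
    (hA : UA ∈ Matrix.unitaryGroup (Fin n → ZMod d) ℂ)
    (hB : UB ∈ Matrix.unitaryGroup (Fin n → ZMod d) ℂ) (keep : Fin k ↪ Fin n)
    (ρ : Matrix (Fin n → ZMod d × ZMod d) (Fin n → ZMod d × ZMod d) ℂ) :
    ((Protocol.finish UA UB keep).run ρ).trace = ρ.trace := by
  rw [Matrix.mem_unitaryGroup_iff', Matrix.star_eq_conjTranspose] at hA hB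
  rw [Protocol.run, trace_discardRest, Matrix.trace_mul_cycle, localOp_conjTranspose_mul, hA, hB,
    localOp_one, one_mul]

theorem Protocol.trace_run_measure {M : Matrix (Fin n → ZMod d) (Fin n → ZMod d) ℂ}
    {next : ZMod d → ZMod d → Protocol d n k} (hM : ∑ b, (eigenProj M b)ᴴ * eigenProj M b = 1)
    (h : ∀ a b ρ, ((next a b).run ρ).trace = ρ.trace)
    (ρ : Matrix (Fin n → ZMod d × ZMod d) (Fin n → ZMod d × ZMod d) ℂ) :
    ((Protocol.measure M next).run ρ).trace = ρ.trace := by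
  simp only [Protocol.run, Matrix.trace_sum, h]
  simp_rw [Matrix.trace_mul_cycle _ ρ, localOp_conjTranspose_mul, ← Matrix.trace_sum,
    ← Finset.sum_mul]
  rw [sum_localOp, hM, localOp_one, one_mul]

/-- A pure state that is proportional to a perfect pair on one system yields a multiple of the
perfect pair. -/
theorem discardRest_pureState_mem_span (i : Fin 4)
    (G : Matrix (Fin 3 → ZMod d) (Fin 3 → ZMod d) ℂ) :
    discardRest (onlyPair i) (pureState (actOn (Fin.succAboveEmb i) G)) ∈
      Submodule.span ℂ {eprPairs (ZMod d) 1} := by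
  rw [Submodule.mem_span_singleton]
  have hd : (d : ℂ) ≠ 0 := NeZero.ne _
  -- The weight is the squared norm of `G` from tracing out the other pairs; the factor `d` undoes
  -- the normalisation in `eprPairs`.
  refine ⟨d * ∑ z : Fin 3 → ZMod d × ZMod d, G (fun j => (z j).1) (fun j => (z j).2) *
    star (G (fun j => (z j).1) fun j => (z j).2), ?_⟩
  ext u v
  have h1 : ∀ x y : Fin 4 → ZMod d × ZMod d, ((∀ j, x (onlyPair i j) = u j) ∧
      (∀ j, y (onlyPair i j) = v j) ∧ ∀ j, (∀ l, onlyPair i l ≠ j) → x j = y j) ↔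
      (x i = u 0 ∧ y i = v 0 ∧ ∀ j, i ≠ j → x j = y j) := by
    intro x y
    simp only [Fin.forall_fin_one]
    rfl
  have h2 : ∀ x y : Fin 4 → ZMod d, AgreeOff (Fin.succAboveEmb i) x y ↔ x i = y i := by
    intro x y
    constructor
    · intro h
      exact h i fun j => Fin.succAbove_ne i j
    · intro h j hj
      by_cases hij : j = i
      · rw [hij, h]
      · obtain ⟨l, hl⟩ := Fin.exists_succAbove_eq hij
        exact absurd hl (hj l)
  simp only [discardRest, Matrix.of_apply, h1]
  rw [← Equiv.sum_comp (Fin.insertNthEquiv (fun _ => ZMod d × ZMod d) i), Fintype.sum_prod_type,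
    Finset.sum_eq_single (u 0)]
  rotate_left
  · intro p _ hp
    refine Finset.sum_eq_zero fun z _ => Finset.sum_eq_zero fun y _ => if_neg fun h => hp ?_
    simpa using h.1
  · simp
  have h3 : ∀ z : Fin 3 → ZMod d × ZMod d,
      (∑ y : Fin 4 → ZMod d × ZMod d,
        if Fin.insertNth (α := fun _ => ZMod d × ZMod d) i (u 0) z i = u 0 ∧ y i = v 0 ∧
          ∀ j, i ≠ j → Fin.insertNth (α := fun _ => ZMod d × ZMod d) i (u 0) z j = y j then
        pureState (actOn (Fin.succAboveEmb i) G) (i.insertNth (u 0) z) y else 0) =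
      pureState (actOn (Fin.succAboveEmb i) G) (i.insertNth (u 0) z) (i.insertNth (v 0) z) := by
    intro z
    rw [Finset.sum_eq_single (i.insertNth (v 0) z)]
    · rw [if_pos]
      refine ⟨by simp, by simp, fun j hj => ?_⟩
      obtain ⟨l, rfl⟩ := Fin.exists_succAbove_eq hj.symm
      simp
    · intro y _ hy
      refine if_neg ?_
      rintro ⟨-, h4, h5⟩
      refine hy ?_
      rw [Fin.eq_insertNth_iff]
      refine ⟨h4, ?_⟩
      funext l
      rw [Fin.removeNth, ← h5 _ (Fin.succAbove_ne i l).symm]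
      simp
    · simp
  refine Eq.trans ?_ (Finset.sum_congr rfl fun z _ => h3 z).symm
  simp only [pureState, Matrix.of_apply, actOn_apply, h2, Fin.insertNth_apply_same,
    Fin.succAboveEmb_apply, Fin.insertNth_apply_succAbove]
  simp only [eprPairs, Matrix.smul_apply, Matrix.of_apply, Fin.forall_fin_one, ZMod.card, pow_one,
    smul_eq_mul]
  by_cases h6 : (u 0).1 = (u 0).2
  · by_cases h7 : (v 0).1 = (v 0).2
    · simp [h6, h7]
      field_simp
    · simp [h7]
  · simp [h6]

end Run

/-! ### The four-pair protocol corrects one error -/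

section FourPairs

theorem actOn_diagonal {α : Type} [DecidableEq α] {m n : ℕ} (e : Fin m ↪ Fin n)
    (w : (Fin m → α) → ℂ) :
    actOn e (Matrix.diagonal w) = Matrix.diagonal fun x => w fun j => x (e j) := by
  ext x y
  rw [actOn_apply, Matrix.diagonal_apply, Matrix.diagonal_apply]
  by_cases hxy : x = y
  · subst hxy
    simp [AgreeOff]
  · rw [if_neg hxy]
    split_ifs with h h'
    · exact absurd (h.eq (congrFun h')) hxy
    · rfl
    · rfl

theorem tensor_one_eq_actOn (P Q R : Matrix (ZMod 3) (ZMod 3) ℂ) :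
    tensor ![P, Q, R, 1] = actOn firstThree (tensor ![P, Q, R]) := by
  ext x y
  have h : AgreeOff firstThree x y ↔ x 3 = y 3 := by
    refine ⟨fun h => h 3 (by decide), fun h i hi => ?_⟩
    fin_cases i
    · exact absurd rfl (hi 0)
    · exact absurd rfl (hi 1)
    · exact absurd rfl (hi 2)
    · exact h
  rw [actOn_apply, tensor, tensor, Matrix.of_apply, Matrix.of_apply, Fin.prod_univ_four,
    Fin.prod_univ_three, if_congr h rfl rfl]
  change P (x 0) (y 0) * Q (x 1) (y 1) * R (x 2) (y 2) * (1 : Matrix _ _ ℂ) (x 3) (y 3) =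
    if x 3 = y 3 then P (x 0) (y 0) * Q (x 1) (y 1) * R (x 2) (y 2) else 0
  rw [Matrix.one_apply, mul_ite, mul_one, mul_zero]

theorem xxx_mul_zzz : tensor ![shiftX 3, shiftX 3, shiftX 3] *
    tensor ![clockZ 3, clockZ 3, clockZ 3] =
    tensor ![clockZ 3, clockZ 3, clockZ 3] * tensor ![shiftX 3, shiftX 3, shiftX 3] := by
  ext x y
  rw [zzz_eq, Matrix.mul_diagonal, Matrix.diagonal_mul, xxx_apply]
  split_ifs with h
  · have h3 : (3 : ZMod 3) = 0 := rfl
    have h1 : ∑ i, (y i + 1) = ∑ i, y i := by simp [Finset.sum_add_distrib, h3]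
    rw [h, mul_comm]
    congr 2
    exact h1.symm
  · ring

theorem xxx_pow : tensor ![shiftX 3, shiftX 3, shiftX 3] ^ 3 = 1 := by
  ext x y
  have h3 : (3 : ZMod 3) = 0 := rfl
  have h : y + 1 + 1 + 1 = y := by
    funext i
    simp only [Pi.add_apply, Pi.one_apply]
    linear_combination h3
  rw [pow_succ, pow_two, mul_xxx_apply, mul_xxx_apply, xxx_apply, h, Matrix.one_apply]

theorem zzz_pow : tensor ![clockZ 3, clockZ 3, clockZ 3] ^ 3 = 1 := by
  have h3 : ((3 : ℕ) : ZMod 3) = 0 := rfl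
  rw [zzz_eq, Matrix.diagonal_pow, ← Matrix.diagonal_one]
  congr 1
  funext x
  rw [Pi.pow_apply, ← chi_natCast_mul, h3, zero_mul, chi_zero]

theorem fourPairProtocol_isTwoEPP {DA DB : (Fin 2 → ZMod 3) →
    Matrix (Fin 3 → ZMod 3) (Fin 3 → ZMod 3) ℂ}
    (hA : ∀ s, DA s ∈ Matrix.unitaryGroup (Fin 3 → ZMod 3) ℂ)
    (hB : ∀ s, DB s ∈ Matrix.unitaryGroup (Fin 3 → ZMod 3) ℂ) :
    (fourPairProtocol DA DB).IsTwoEPP := by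
  refine ⟨Submonoid.subset_closure ⟨_, fun i => ?_, rfl⟩, ?_, by simp, fun a₁ b₁ =>
    ⟨Submonoid.subset_closure ⟨_, fun i => ?_, rfl⟩, ?_, ?_, fun a₂ b₂ => ?_⟩⟩
  · fin_cases i <;> simp
  · rw [tensor_one_eq_actOn, ← actOn_pow, xxx_pow, actOn_one]
  · fin_cases i <;> simp
  · rw [tensor_one_eq_actOn, ← actOn_pow, zzz_pow, actOn_one]
  · simp only [List.mem_singleton, forall_eq]
    rw [tensor_one_eq_actOn, tensor_one_eq_actOn, Commute, SemiconjBy, ← actOn_mul, ← actOn_mul,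
      xxx_mul_zzz]
  · beta_reduce
    split_ifs
    · exact ⟨actOn_mem_unitaryGroup _ (hA _), actOn_mem_unitaryGroup _ (hB _)⟩
    · exact ⟨one_mem _, one_mem _⟩

theorem trace_run_fourPairProtocol {DA DB : (Fin 2 → ZMod 3) →
    Matrix (Fin 3 → ZMod 3) (Fin 3 → ZMod 3) ℂ}
    (hA : ∀ s, DA s ∈ Matrix.unitaryGroup (Fin 3 → ZMod 3) ℂ)
    (hB : ∀ s, DB s ∈ Matrix.unitaryGroup (Fin 3 → ZMod 3) ℂ)
    (ρ : Matrix (Fin 4 → ZMod 3 × ZMod 3) (Fin 4 → ZMod 3 × ZMod 3) ℂ) :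
    ((fourPairProtocol DA DB).run ρ).trace = ρ.trace := by
  have hM : ∀ M : Matrix (Fin 3 → ZMod 3) (Fin 3 → ZMod 3) ℂ,
      ∑ b, (eigenProj M b)ᴴ * eigenProj M b = 1 →
      ∑ b, (eigenProj (actOn firstThree M) b)ᴴ * eigenProj (actOn firstThree M) b = 1 := by
    intro M h
    simp only [actOn_eigenProj, ← actOn_conjTranspose, ← actOn_mul]
    rw [← actOn_sum, h, actOn_one]
  refine Protocol.trace_run_measure ?_ (fun a₁ b₁ => Protocol.trace_run_measure ?_
    fun a₂ b₂ ρ => ?_) ρ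
  · rw [tensor_one_eq_actOn]
    exact hM _ (sum_eigenProj_mul (decode_conjTranspose_mul 0) (decode_mul_xxx 0))
  · rw [tensor_one_eq_actOn]
    exact hM _ (sum_eigenProj_mul (decode_conjTranspose_mul 0) (decode_mul_zzz 0))
  · split_ifs
    · exact Protocol.trace_run_finish (actOn_mem_unitaryGroup _ (hA _))
        (actOn_mem_unitaryGroup _ (hB _)) _ _
    · exact Protocol.trace_run_finish (one_mem _) (one_mem _) _ _

/-- The projector onto the syndrome space of `a`. -/
noncomputable def syndromeProj (a : Fin 2 → ZMod 3) :
    Matrix (Fin 3 → ZMod 3) (Fin 3 → ZMod 3) ℂ :=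
  eigenProj (tensor ![clockZ 3, clockZ 3, clockZ 3]) (a 1) *
    eigenProj (tensor ![shiftX 3, shiftX 3, shiftX 3]) (a 0)

theorem decode_mul_conjTranspose (a : Fin 2 → ZMod 3) : decode a * (decode a)ᴴ = 1 :=
  mul_eq_one_comm.1 (decode_conjTranspose_mul a)

theorem diagonal_ite_mul {ι : Type*} [Fintype ι] [DecidableEq ι] (p q : ι → Prop) [DecidablePred p]
    [DecidablePred q] : Matrix.diagonal (fun y => if p y then (1 : ℂ) else 0) *
      Matrix.diagonal (fun y => if q y then (1 : ℂ) else 0) =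
      Matrix.diagonal fun y => if p y ∧ q y then (1 : ℂ) else 0 := by
  rw [Matrix.diagonal_mul_diagonal]
  congr 1
  funext y
  split_ifs <;> simp_all

/-- Every decoding operation diagonalises all the syndrome projectors. -/
theorem decode_mul_syndromeProj (c a : Fin 2 → ZMod 3) :
    decode c * syndromeProj a =
      Matrix.diagonal (fun y => if y 2 + c 1 = a 1 ∧ y 1 + c 0 = a 0 then 1 else 0) * decode c := by
  rw [syndromeProj, ← Matrix.mul_assoc, mul_eigenProj (decode_mul_zzz c), Matrix.mul_assoc,
    mul_eigenProj (decode_mul_xxx c), ← Matrix.mul_assoc, diagonal_ite_mul]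

theorem syndromeProj_eq (c a : Fin 2 → ZMod 3) :
    syndromeProj a = (decode c)ᴴ *
      Matrix.diagonal (fun y => if y 2 + c 1 = a 1 ∧ y 1 + c 0 = a 0 then 1 else 0) * decode c := by
  rw [Matrix.mul_assoc, ← decode_mul_syndromeProj, ← Matrix.mul_assoc, decode_conjTranspose_mul,
    Matrix.one_mul]

theorem syndromeProj_mul (a b : Fin 2 → ZMod 3) :
    syndromeProj a * syndromeProj b = if a = b then syndromeProj a else 0 := by
  rw [syndromeProj_eq 0 a, Matrix.mul_assoc, decode_mul_syndromeProj, ← Matrix.mul_assoc,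
    Matrix.mul_assoc (decode 0)ᴴ, diagonal_ite_mul]
  split_ifs with h
  · simp [h]
  · have h1 : ∀ y : Fin 3 → ZMod 3, ¬ ((y 2 + (0 : Fin 2 → ZMod 3) 1 = a 1 ∧
        y 1 + (0 : Fin 2 → ZMod 3) 0 = a 0) ∧ y 2 + (0 : Fin 2 → ZMod 3) 1 = b 1 ∧
        y 1 + (0 : Fin 2 → ZMod 3) 0 = b 0) := by
      rintro y ⟨⟨h1, h2⟩, h3, h4⟩
      refine h (funext fun i => ?_)
      fin_cases i
      · exact h2.symm.trans h4
      · exact h1.symm.trans h3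
    simp only [h1, if_false, Matrix.diagonal_zero, Matrix.mul_zero, Matrix.zero_mul]

/-- Bob's projections act on the amplitude matrix from the right, transposed. This turns them into a
syndrome projector comparable with Alice's, so "no error detected" means equal syndromes. -/
theorem transpose_eigenProj_mul (b₁ b₂ : ZMod 3) :
    (eigenProj (tensor ![shiftX 3, shiftX 3, shiftX 3]) b₁)ᵀ *
      (eigenProj (tensor ![clockZ 3, clockZ 3, clockZ 3]) b₂)ᵀ = syndromeProj ![-b₁, b₂] := by
  have h1 : (tensor ![clockZ 3, clockZ 3, clockZ 3])ᵀ = tensor ![clockZ 3, clockZ 3, clockZ 3] := by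
    rw [zzz_eq, Matrix.diagonal_transpose]
  have h2 : decode 0 * ((eigenProj (tensor ![shiftX 3, shiftX 3, shiftX 3]) b₁)ᵀ *
      (eigenProj (tensor ![clockZ 3, clockZ 3, clockZ 3]) b₂)ᵀ) =
      decode 0 * syndromeProj ![-b₁, b₂] := by
    rw [eigenProj_transpose, eigenProj_transpose, h1, ← Matrix.mul_assoc,
      mul_eigenProj (decode_mul_xxx_transpose 0), Matrix.mul_assoc,
      mul_eigenProj (decode_mul_zzz 0), ← Matrix.mul_assoc, diagonal_ite_mul,
      decode_mul_syndromeProj]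
    congr 2
    funext y
    simp [neg_eq_iff_eq_neg, and_comm]
  have h3 := congrArg (fun M => (decode 0)ᴴ * M) h2
  simpa only [← Matrix.mul_assoc (decode 0)ᴴ, decode_conjTranspose_mul, Matrix.one_mul] using h3

/-- The projector onto the decoded positions `ℂ³ ⊗ |00⟩`. -/
noncomputable def decodedProj : Matrix (Fin 3 → ZMod 3) (Fin 3 → ZMod 3) ℂ :=
  Matrix.diagonal fun y => if y 2 = 0 ∧ y 1 = 0 then 1 else 0

theorem decode_mul_syndromeProj_self (a : Fin 2 → ZMod 3) :
    decode a * syndromeProj a = decodedProj * decode a := by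
  have h := decode_mul_syndromeProj a a
  simp only [add_eq_right] at h
  exact h

theorem syndromeProj_mul_decode (a : Fin 2 → ZMod 3) :
    syndromeProj a * (decode a)ᴴ = (decode a)ᴴ * decodedProj := by
  have := syndromeProj_eq a a
  simp only [add_eq_right] at this
  rw [this, Matrix.mul_assoc, decode_mul_conjTranspose, Matrix.mul_one, decodedProj]

/-- Projecting an error on one system back to a syndrome space and decoding leaves a multiple of the
projector onto the decoded positions. -/
theorem decode_projected_error {m : ℕ} (hm : m ≤ 1) (e : Fin m ↪ Fin 3)
    (E : Matrix (Fin m → ZMod 3) (Fin m → ZMod 3) ℂ) (a : Fin 2 → ZMod 3) :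
    ∃ c : ℂ, decode a * (syndromeProj a * actOn e E * syndromeProj a) * (decode a)ᴴ =
      c • decodedProj := by
  obtain ⟨c, hc⟩ := exists_detection_constant hm e E
  refine ⟨c, ?_⟩
  -- The projectors pass through `decode` and cut down to decoded positions. The entries left are
  -- matrix elements of the error between vectors of the syndrome space, to which detection applies.
  have h1 : decode a * (syndromeProj a * actOn e E * syndromeProj a) * (decode a)ᴴ =
      decodedProj * (decode a * actOn e E * (decode a)ᴴ) * decodedProj := by
    simp only [Matrix.mul_assoc]
    rw [syndromeProj_mul_decode, ← Matrix.mul_assoc (decode a) (syndromeProj a),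
      decode_mul_syndromeProj_self, Matrix.mul_assoc]
  rw [h1]
  ext y y'
  rw [decodedProj, Matrix.mul_diagonal, Matrix.diagonal_mul, Matrix.smul_apply,
    Matrix.diagonal_apply]
  by_cases hy : y 2 = 0 ∧ y 1 = 0
  · by_cases hy' : y' 2 = 0 ∧ y' 1 = 0
    · have h2 := hc a _ (star_decode_mem a hy.2 hy.1) _ (star_decode_mem a hy'.2 hy'.1)
      have h3 : (decode a * actOn e E * (decode a)ᴴ) y y' =
          star (fun x => star (decode a y x)) ⬝ᵥ
            (actOn e E *ᵥ fun x => star (decode a y' x)) := by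
        rw [Matrix.mul_assoc, Matrix.mul_apply]
        simp only [dotProduct, Pi.star_apply, star_star]
        rfl
      have h4 : star (fun x => star (decode a y x)) ⬝ᵥ (fun x => star (decode a y' x)) =
          (1 : Matrix (Fin 3 → ZMod 3) (Fin 3 → ZMod 3) ℂ) y y' := by
        rw [← decode_mul_conjTranspose a, Matrix.mul_apply]
        simp only [dotProduct, Pi.star_apply, star_star]
        rfl
      rw [h3, h2, h4, Matrix.one_apply, if_pos hy, if_pos hy', one_mul, mul_one, smul_eq_mul]
    · have : y ≠ y' := fun h => hy' (h ▸ hy)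
      simp [hy', this]
  · simp [hy]

end FourPairs

/-! ### Case analysis over the position of the error and the outcomes. -/

section FourPairsCorrect

theorem firstThree_eq : firstThree = Fin.succAboveEmb (3 : Fin 4) := by
  ext i
  fin_cases i <;> rfl

/-- A set of at most one of four pairs is contained in the first three or consists of the last. -/
theorem embedding_cases {s : ℕ} (hs : s ≤ 1) (e : Fin s ↪ Fin 4) :
    (∃ e' : Fin s ↪ Fin 3, e = e'.trans firstThree) ∨
      (∀ i j, firstThree i ≠ e j) ∧ ∃ e' : Fin s ↪ Fin 3, e = e'.trans (Fin.succAboveEmb 0) := by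
  by_cases h : ∀ j, e j ≠ 3
  · left
    refine ⟨⟨fun j => (e j).castPred (h j), fun j j' hj => e.injective ?_⟩, ?_⟩
    · exact Fin.castPred_inj.1 hj
    · ext j
      rfl
  · right
    push Not at h
    obtain ⟨j, hj⟩ := h
    have hs' : ∀ j', j' = j := fun j' => Fin.ext (by omega)
    -- Skipping `0`, the index `2` among the last three systems is the system `3`.
    refine ⟨fun i j' hij => ?_, ⟨fun _ => 2, fun a b _ => (hs' a).trans (hs' b).symm⟩, ?_⟩
    · rw [hs' j', hj] at hij
      exact absurd hij (Fin.castSucc_lt_last i).ne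
    · ext j'
      rw [hs' j', hj]
      rfl

/-- The condition involves systems `1` and `2` only. Viewed as an operator on the last three systems
it is the identity on system `0`, the form that `discardRest_pureState_mem_span` requires. -/
theorem actOn_decodedProj : actOn firstThree decodedProj = actOn (Fin.succAboveEmb 0)
    (Matrix.diagonal fun z : Fin 3 → ZMod 3 => if z 1 = 0 ∧ z 0 = 0 then (1 : ℂ) else 0) := by
  rw [decodedProj, actOn_diagonal, actOn_diagonal]
  rfl

/-- If no error is detected, decoding restores a perfect pair. -/
theorem decoded_mem_span {s : ℕ} (hs : s ≤ 1) (e : Fin s ↪ Fin 4)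
    (κ : Matrix (Fin s → ZMod 3) (Fin s → ZMod 3) ℂ) (a : Fin 2 → ZMod 3) :
    discardRest (onlyPair 0) (pureState (actOn firstThree (decode a) *
      (actOn firstThree (syndromeProj a) * actOn e κ * actOn firstThree (syndromeProj a)) *
      actOn firstThree (decode a)ᴴ)) ∈ Submodule.span ℂ {eprPairs (ZMod 3) 1} := by
  rcases embedding_cases hs e with ⟨e', rfl⟩ | ⟨he, e', he'⟩
  · obtain ⟨c, hc⟩ := decode_projected_error hs e' κ a
    rw [← actOn_actOn]
    simp only [← actOn_mul]
    rw [hc, actOn_smul, actOn_decodedProj, ← actOn_smul]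
    exact discardRest_pureState_mem_span 0 _
  -- An error in the fourth pair commutes with everything done to the first three, where only
  -- `decodedProj` remains.
  · have h1 : actOn firstThree (decode a) *
        (actOn firstThree (syndromeProj a) * actOn e κ * actOn firstThree (syndromeProj a)) *
        actOn firstThree (decode a)ᴴ = actOn firstThree decodedProj * actOn e κ := by
      rw [Matrix.mul_assoc (actOn firstThree (syndromeProj a)), ← actOn_commute _ _ he]
      simp only [Matrix.mul_assoc]
      rw [← actOn_commute _ _ he]
      simp only [← Matrix.mul_assoc, ← actOn_mul]
      rw [Matrix.mul_assoc (decode a), syndromeProj_mul, if_pos rfl, decode_mul_syndromeProj_self,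
        Matrix.mul_assoc decodedProj, decode_mul_conjTranspose, Matrix.mul_one]
    rw [h1, he', actOn_decodedProj, ← actOn_actOn, ← actOn_mul]
    exact discardRest_pureState_mem_span 0 _

/-- If an error is detected, the fourth pair is perfect. -/
theorem detected_mem_span {s : ℕ} (hs : s ≤ 1) (e : Fin s ↪ Fin 4)
    (κ : Matrix (Fin s → ZMod 3) (Fin s → ZMod 3) ℂ) {a b : Fin 2 → ZMod 3} (hab : a ≠ b) :
    discardRest (onlyPair 3) (pureState
      (actOn firstThree (syndromeProj a) * actOn e κ * actOn firstThree (syndromeProj b))) ∈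
      Submodule.span ℂ {eprPairs (ZMod 3) 1} := by
  rcases embedding_cases hs e with ⟨e', rfl⟩ | ⟨he, -⟩
  · rw [← actOn_actOn]
    simp only [← actOn_mul]
    rw [firstThree_eq]
    exact discardRest_pureState_mem_span 3 _
  -- Different syndromes are orthogonal, so this branch has probability zero; writing 0 as an
  -- operator on the first three systems lets the same lemma conclude.
  · rw [Matrix.mul_assoc, ← actOn_commute _ _ he, ← Matrix.mul_assoc, ← actOn_mul,
      syndromeProj_mul, if_neg hab, actOn_zero, Matrix.zero_mul,
      ← actOn_zero (Fin.succAboveEmb (3 : Fin 4))]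
    exact discardRest_pureState_mem_span 3 _

theorem run_fourPairProtocol_mem_span {s : ℕ} (hs : s ≤ 1) (e : Fin s ↪ Fin 4)
    (κ : Matrix (Fin s → ZMod 3) (Fin s → ZMod 3) ℂ) :
    (fourPairProtocol decode decodeConj).run (pureState (actOn e κ)) ∈
      Submodule.span ℂ {eprPairs (ZMod 3) 1} := by
  rw [fourPairProtocol, Protocol.run]
  refine Submodule.sum_mem _ fun a₁ _ => Submodule.sum_mem _ fun b₁ _ => ?_
  rw [Protocol.run]
  refine Submodule.sum_mem _ fun a₂ _ => Submodule.sum_mem _ fun b₂ _ => ?_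
  rw [tensor_one_eq_actOn, tensor_one_eq_actOn, localOp_mul_pureState_mul,
    localOp_mul_pureState_mul]
  simp only [actOn_eigenProj, ← actOn_transpose]
  have h1 : ∀ A B B' A' : Matrix (Fin 3 → ZMod 3) (Fin 3 → ZMod 3) ℂ,
      actOn firstThree A * (actOn firstThree B * actOn e κ * actOn firstThree B') *
        actOn firstThree A' = actOn firstThree (A * B) * actOn e κ * actOn firstThree (B' * A') := by
    intro A B B' A'
    simp only [actOn_mul, Matrix.mul_assoc]
  rw [h1, transpose_eigenProj_mul]
  have h2 : eigenProj (tensor ![clockZ 3, clockZ 3, clockZ 3]) a₂ *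
    eigenProj (tensor ![shiftX 3, shiftX 3, shiftX 3]) a₁ = syndromeProj ![a₁, a₂] := rfl
  rw [h2]
  split_ifs with h
  · obtain ⟨h3, rfl⟩ := h
    have h4 : -b₁ = a₁ := (eq_neg_of_add_eq_zero_left h3).symm
    -- Bob's decoding is the entrywise conjugate of Alice's, so its transpose is her adjoint.
    have h5 : (decodeConj ![b₁, a₂])ᵀ = (decode ![a₁, a₂])ᴴ := by
      rw [← h4]
      rfl
    rw [Protocol.run, localOp_mul_pureState_mul, ← actOn_transpose, h5, h4]
    exact decoded_mem_span hs e κ _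
  · rw [Protocol.run, localOp_mul_pureState_mul, Matrix.transpose_one, Matrix.mul_one,
      Matrix.one_mul]
    refine detected_mem_span hs e κ fun hab => h ?_
    have h3 : a₁ = -b₁ := congrFun hab 0
    have h4 : a₂ = b₂ := congrFun hab 1
    exact ⟨by rw [h3, neg_add_cancel], h4⟩

theorem fourPairProtocol_corrects : (fourPairProtocol decode decodeConj).Corrects 1 := by
  intro s hs e N
  have h1 : (fourPairProtocol decode decodeConj).run (N.applyOn e (eprPairs (ZMod 3) 4)) ∈
      Submodule.span ℂ {eprPairs (ZMod 3) 1} := by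
    obtain ⟨κ, hκ⟩ := exists_applyOn_eprPairs N e
    rw [hκ, Protocol.run_sum]
    exact Submodule.sum_mem _ fun i _ => run_fourPairProtocol_mem_span hs e (κ i)
  -- The error and the protocol both preserve the trace, which is 1 for perfect pairs; hence `c =
  -- 1`.
  obtain ⟨c, hc⟩ := Submodule.mem_span_singleton.1 h1
  have h2 := trace_run_fourPairProtocol decode_mem_unitaryGroup decodeConj_mem_unitaryGroup
    (N.applyOn e (eprPairs (ZMod 3) 4))
  rw [N.trace_applyOn, trace_eprPairs, ← hc, Matrix.trace_smul, trace_eprPairs, smul_eq_mul,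
    mul_one] at h2
  rw [← hc, h2, one_smul]

end FourPairsCorrect

end QuditEPP

theorem mainTheorem6 :
    -- the stabilizer `XXX, ZZZ` encodes one qutrit in three and detects one error
    (Module.finrank ℂ QuditEPP.threeQutritCode = 3 ^ 1 ∧
      QuditEPP.Detects QuditEPP.threeQutritCode 1) ∧
    -- the four-pair protocol is a 2-EPP that yields one perfect pair despite one error
    (∃ DA DB : (Fin 2 → ZMod 3) → Matrix (Fin 3 → ZMod 3) (Fin 3 → ZMod 3) ℂ,
      QuditEPP.IsDecoding QuditEPP.threeQutritGenerators 1 DA ∧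
      QuditEPP.IsDecoding QuditEPP.threeQutritGenerators 1 DB ∧
      (QuditEPP.fourPairProtocol DA DB).IsTwoEPP ∧
      (QuditEPP.fourPairProtocol DA DB).Corrects 1) ∧
    -- every QECC, on qudits of any dimension, obeys the quantum Singleton bound
    (∀ d n k t : ℕ, 2 ≤ d → 1 ≤ k →
      (∃ C : QuditEPP.QECC (Fin d) n k, C.Corrects t) → 4 * t + k ≤ n) ∧
    -- the parameters `n = 4`, `k = 1`, `t = 1` of the 2-EPP violate it, and no QECC has them
    (¬ (4 * 1 + 1 ≤ 4) ∧ ¬ ∃ C : QuditEPP.QECC (Fin 3) 4 1, C.Corrects 1) := by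
  refine ⟨⟨QuditEPP.threeQutritCode_finrank, QuditEPP.threeQutritCode_detects⟩,
    ⟨QuditEPP.decode, QuditEPP.decodeConj, QuditEPP.decode_isDecoding,
      QuditEPP.decodeConj_isDecoding,
      QuditEPP.fourPairProtocol_isTwoEPP QuditEPP.decode_mem_unitaryGroup
        QuditEPP.decodeConj_mem_unitaryGroup,
      QuditEPP.fourPairProtocol_corrects⟩,
    fun d n k t hd hk ⟨C, hC⟩ => hC.singleton_bound hd hk, by norm_num, fun ⟨C, hC⟩ => ?_⟩
  have := hC.singleton_bound (by norm_num) le_rfl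
  omega
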